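/- Let $m,\ell,K,N$ be integers with $m\ge 1$, $0\le \ell\le m$, $K,N\ge 0$, let $1<p<\infty$ and $\lambda>0$, and let $0=x_0\le x_1\le\dots\le x_K\le x_{K+1}=1$. Let $W_{m,p}$ be the space of functions $f$ on $[0,1]$ such that $f,f',\dots,f^{(m-1)}$ exist and are absolutely continuous and $f^{(m)}\in L_p[0,1]$, with norm $\bigl(\sum_{j<m}|f^{(j)}(0)|^p+\int_0^1|f^{(m)}|^p\bigr)^{1/p}$. Let $$V=V^{K,\ell}_{m,p}[x_1,\dots,x_K]=\{f\in W_{m,p} : (-1)^{k-1}f^{(\ell)}(t)\ge 0 \text{ for } x_{k-1}\le t\le x_k,\ k=1,\dots,K+1\},$$ where for $\ell=m$ the inequality is required only for almost every $t$. Let $L_1,\dots,L_N$ be bounded linear functionals on $W_{m,p}$, written $L_if=\langle h_i,f\rangle$, that separate polynomials of degree $m-1$: if $c_0,\dots,c_{m-1}\in\mathbb R$ and $\langle h_i,\sum_{k<m}c_kt^k\rangle=0$ for all $i$, then all $c_k=0$. Let $y\in\mathbb R^N$, let $\rho_1,\dots,\rho_N:\mathbb R\to\mathbb R$ be strictly convex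 and continuous, and put $$\mathrm{VP}[f]=\frac{\lambda}{p}\int_0^1|f^{(m)}(s)|^p\,ds+\sum_{i=1}^N\rho_i(\langle h_i,f\rangle-y_i).$$ 1. If every $\rho_i$ is coercive, i.e. $\rho_i(z)\to+\infty$ as $|z|\to\infty$, then $\mathrm{VP}$ has a unique minimizer over $V$. Even without coercivity, $\mathrm{VP}$ has at most one minimizer over $V$. 2. For every minimizer $\hat f$ of $\mathrm{VP}$ over $V$ there are numbers $a_1,\dots,a_N$ such that $a_i$ is a subgradient of $\rho_i$ at $\langle h_i,\hat f\rangle-y_i$ (hence $a_i=\rho_i'(\langle h_i,\hat f\rangle-y_i)$ whenever $\rho_i$ is differentiable there), and such that $$(-1)^m\lambda\, d^m\bigl[|\hat f^{(m)}|^{p-2}\hat f^{(m)}\bigr]+\sum_{i=1}^N a_i\,h_i=0$$ holds in the sense of distributions on every open set $U\subseteq(0,1)$ on which $|\hat f^{(\ell)}|>0$ (everywhere on $U$ if $\ell<m$, almost everywhere on $U$ if $\ell=m$). That is, for every $\varphi\in C_c^\infty(U)$, $\ \lambda\int_0^1|\hat f^{(m)}|^{p-2}\hat f^{(m)}\varphi^{(m)}\,dt+\sum_{i=1}^N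 a_i\langle h_i,\varphi\rangle=0$. -/

import Mathlib

open Set Filter Topology MeasureTheory
open scoped unitInterval ContDiff

namespace RobustSpline

noncomputable section

/-- The `j`-th derivative `f^{(j)}` of a function `f` on `[0,1]` (one-sided at the endpoints), as a
function of a real variable. Only its values on `[0,1]` are meaningful; they do not depend on the
chosen extension of `f` to the line. -/
def D (j : ℕ) (f : I → ℝ) : ℝ → ℝ :=
  iteratedDerivWithin j (IccExtend zero_le_one f) (Icc (0 : ℝ) 1)

/-- Membership in `W_{m,p}[0,1]` (`m ≥ 1`): the derivatives `f, f', …, f^{(m-1)}` exist and are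
absolutely continuous on `[0,1]`, and the almost everywhere defined function `f^{(m)}`
belongs to `L_p[0,1]`. -/
structure MemW (m : ℕ) (p : ℝ) (f : I → ℝ) : Prop where
  contDiffOn : ContDiffOn ℝ (m - 1 : ℕ) (IccExtend zero_le_one f) (Icc (0 : ℝ) 1)
  absCont : ∀ j < m, AbsolutelyContinuousOnInterval (D j f) 0 1
  memLp : MemLp (D m f) (ENNReal.ofReal p) (volume.restrict (Icc (0 : ℝ) 1))

theorem D_smul (j : ℕ) (c : ℝ) (f : I → ℝ) : D j (c • f) = c • D j f := by
  funext t
  have h : IccExtend zero_le_one (c • f) = c • IccExtend zero_le_one f := rfl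
  rw [D, h, iteratedDerivWithin_const_smul_field]
  rfl

theorem D_add_eqOn {m : ℕ} {p : ℝ} {f g : I → ℝ} (hf : MemW m p f) (hg : MemW m p g)
    {j : ℕ} (hj : j < m) : EqOn (D j (f + g)) (D j f + D j g) (Icc (0 : ℝ) 1) := by
  intro t ht
  have h : IccExtend zero_le_one (f + g) = IccExtend zero_le_one f + IccExtend zero_le_one g := rfl
  have hjm : ((j : ℕ) : WithTop ℕ∞) ≤ ((m - 1 : ℕ) : WithTop ℕ∞) := by
    exact_mod_cast Nat.le_sub_one_of_lt hj
  rw [D, h, iteratedDerivWithin_add ht (uniqueDiffOn_Icc zero_lt_one)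
    ((hf.contDiffOn.of_le hjm) t ht) ((hg.contDiffOn.of_le hjm) t ht)]
  rfl

theorem ae_differentiableWithinAt {m : ℕ} {p : ℝ} {f : I → ℝ} (hf : MemW m p f) {j : ℕ}
    (hj : j < m) : ∀ᵐ t ∂(volume.restrict (Icc (0 : ℝ) 1)),
      DifferentiableWithinAt ℝ (D j f) (Icc (0 : ℝ) 1) t := by
  have h := (hf.absCont j hj).boundedVariationOn
  rw [uIcc_of_le zero_le_one] at h
  exact h.locallyBoundedVariationOn.ae_differentiableWithinAt measurableSet_Icc

theorem D_add_ae {m : ℕ} {p : ℝ} {f g : I → ℝ} (hf : MemW m p f) (hg : MemW m p g) :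
    D m (f + g) =ᵐ[volume.restrict (Icc (0 : ℝ) 1)] D m f + D m g := by
  rcases m with _ | j
  · exact Filter.Eventually.of_forall fun t => by simp [D, IccExtend]
  filter_upwards [ae_differentiableWithinAt hf j.lt_succ_self,
    ae_differentiableWithinAt hg j.lt_succ_self, ae_restrict_mem measurableSet_Icc] with t h1 h2 ht
  have key : D (j + 1) (f + g) t = derivWithin (D j (f + g)) (Icc (0 : ℝ) 1) t :=
    congrFun iteratedDerivWithin_succ t
  have key1 : D (j + 1) f t = derivWithin (D j f) (Icc (0 : ℝ) 1) t :=
    congrFun iteratedDerivWithin_succ t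
  have key2 : D (j + 1) g t = derivWithin (D j g) (Icc (0 : ℝ) 1) t :=
    congrFun iteratedDerivWithin_succ t
  rw [Pi.add_apply, key, key1, key2,
    derivWithin_congr (D_add_eqOn hf hg j.lt_succ_self) (D_add_eqOn hf hg j.lt_succ_self ht),
    derivWithin_add h1 h2]

theorem absCont_congr {u v : ℝ → ℝ}
    (hu : AbsolutelyContinuousOnInterval u 0 1) (h : EqOn v u (Icc (0 : ℝ) 1)) :
    AbsolutelyContinuousOnInterval v 0 1 := by
  rw [absolutelyContinuousOnInterval_iff] at hu ⊢
  intro ε hε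
  obtain ⟨δ, hδ, H⟩ := hu ε hε
  refine ⟨δ, hδ, fun E hE hs => ?_⟩
  refine lt_of_eq_of_lt (Finset.sum_congr rfl fun i hi => ?_) (H E hE hs)
  have := hE.1 i hi
  rw [uIcc_of_le zero_le_one] at this
  rw [h this.1, h this.2]

theorem contDiff_iteratedDeriv {g : ℝ → ℝ} (hg : ContDiff ℝ ∞ g) (j : ℕ) :
    ContDiff ℝ 1 (iteratedDeriv j g) := by
  rw [iteratedDeriv_eq_iterate]
  exact ContDiff.iterate_deriv' 1 j (hg.of_le (by exact_mod_cast le_top))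

/-- The derivatives of the restriction of a smooth function are the usual ones. -/
theorem D_restrict {g : ℝ → ℝ} (hg : ContDiff ℝ ∞ g) (j : ℕ) :
    EqOn (D j (fun t : I => g t)) (iteratedDeriv j g) (Icc (0 : ℝ) 1) := by
  intro t ht
  have h : EqOn (IccExtend zero_le_one (fun t : I => g t)) g (Icc (0 : ℝ) 1) := fun s hs => by
    rw [IccExtend_of_mem _ _ hs]
  rw [D, iteratedDerivWithin_congr h ht,
    iteratedDerivWithin_eq_iteratedDeriv (uniqueDiffOn_Icc zero_lt_one)
      ((hg.of_le (by exact_mod_cast le_top)).contDiffAt) ht]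

/-- Restrictions to `[0,1]` of smooth functions belong to `W_{m,p}`. -/
theorem memW_of_contDiff {g : ℝ → ℝ} (hg : ContDiff ℝ ∞ g) (m : ℕ) (p : ℝ) :
    MemW m p (fun t : I => g t) where
  contDiffOn := by
    refine ContDiffOn.congr (f := g) (contDiff_infty.1 hg _).contDiffOn
      fun s hs => ?_
    rw [IccExtend_of_mem _ _ hs]
  absCont := fun j _ => absCont_congr (contDiff_iteratedDeriv hg j).contDiffOn.absolutelyContinuousOnInterval
      (D_restrict hg j)
  memLp := by
    have hc : Continuous (iteratedDeriv m g) := (contDiff_iteratedDeriv hg m).continuous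
    have hae : D m (fun t : I => g t) =ᵐ[volume.restrict (Icc (0 : ℝ) 1)] iteratedDeriv m g :=
      (ae_restrict_mem measurableSet_Icc).mono fun t ht => D_restrict hg m ht
    refine (memLp_congr_ae hae).2 ?_
    obtain ⟨C, hC⟩ := isCompact_Icc.exists_bound_of_continuousOn (s := Icc (0 : ℝ) 1)
      hc.continuousOn
    exact MemLp.of_bound hc.aestronglyMeasurable C
      ((ae_restrict_mem measurableSet_Icc).mono fun t ht => hC t ht)

/-- The Sobolev space `W_{m,p}[0,1]`, as a vector space of functions on `[0,1]`. -/
def W (m : ℕ) (p : ℝ) : Submodule ℝ (I → ℝ) where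
  carrier := {f | MemW m p f}
  zero_mem' := memW_of_contDiff (g := fun _ => 0) contDiff_const m p
  add_mem' := fun {f g} hf hg =>
    { contDiffOn := hf.contDiffOn.add hg.contDiffOn
      absCont := fun j hj =>
        absCont_congr ((hf.absCont j hj).add (hg.absCont j hj)) (D_add_eqOn hf hg hj)
      memLp := (memLp_congr_ae (D_add_ae hf hg)).2 (hf.memLp.add hg.memLp) }
  smul_mem' := fun c f hf =>
    { contDiffOn := hf.contDiffOn.const_smul c
      absCont := fun j hj => by
        rw [D_smul]
        exact (hf.absCont j hj).const_mul c
      memLp := by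
        rw [D_smul]
        exact hf.memLp.const_smul c }

/-- The element of `W_{m,p}` given by (the restriction to `[0,1]` of) a smooth function. -/
def ofSmooth (m : ℕ) (p : ℝ) (g : ℝ → ℝ) (hg : ContDiff ℝ ∞ g) : W m p :=
  ⟨fun t => g t, memW_of_contDiff hg m p⟩

/-- The norm `(∑_{j<m} |f^{(j)}(0)|^p + ∫_0^1 |f^{(m)}|^p)^{1/p}` of `W_{m,p}`. -/
def normW {m : ℕ} {p : ℝ} (f : W m p) : ℝ :=
  (∑ j ∈ Finset.range m, |D j f 0| ^ p + ∫ t in (0 : ℝ)..1, |D m f t| ^ p) ^ (1 / p)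

/-- `L` is a bounded linear functional on `W_{m,p}` for the norm `normW`. -/
def IsBoundedFunctional {m : ℕ} {p : ℝ} (L : W m p →ₗ[ℝ] ℝ) : Prop :=
  ∃ C : ℝ, ∀ f : W m p, |L f| ≤ C * normW f

/-- The polynomial `∑_{k<m} c_k t^k` as an element of `W_{m,p}`. -/
def poly (m : ℕ) (p : ℝ) (c : Fin m → ℝ) : W m p :=
  ofSmooth m p (fun t => ∑ k : Fin m, c k * t ^ (k : ℕ)) (by fun_prop)

/-- The functionals `L_i` separate polynomials of degree `m - 1`. -/
def SeparatesPolynomials {m : ℕ} {p : ℝ} {N : ℕ} (L : Fin N → W m p →ₗ[ℝ] ℝ) : Prop :=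
  ∀ c : Fin m → ℝ, (∀ i, L i (poly m p c) = 0) → c = 0

/-- The points `x_0 = 0, x_1, …, x_K, x_{K+1} = 1`. -/
def knots {K : ℕ} (x : Fin K → ℝ) : Fin (K + 2) → ℝ :=
  Fin.cons 0 (Fin.snoc x 1 : Fin (K + 1) → ℝ)

/-- The cone `V^{K,ℓ}_{m,p}[x_1,…,x_K]`: `(-1)^{k-1} f^{(ℓ)} ≥ 0` on `[x_{k-1}, x_k]` for
`k = 1, …, K+1` (here `k = j + 1`), everywhere if `ℓ < m` and almost everywhere if `ℓ = m`. -/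
def cone {K : ℕ} (ℓ m : ℕ) (p : ℝ) (x : Fin K → ℝ) : Set (W m p) :=
  {f | ∀ j : Fin (K + 1),
    (ℓ < m → ∀ t ∈ Icc (knots x j.castSucc) (knots x j.succ),
      0 ≤ (-1 : ℝ) ^ (j : ℕ) * D ℓ f t) ∧
    (ℓ = m → ∀ᵐ t ∂(volume.restrict (Icc (knots x j.castSucc) (knots x j.succ))),
      0 ≤ (-1 : ℝ) ^ (j : ℕ) * D ℓ f t)}

/-- The robust penalized functional
`VP[f] = (λ/p) ∫_0^1 |f^{(m)}|^p + ∑_i ρ_i(L_i f - y_i)`. -/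
def VP {m : ℕ} {p : ℝ} {N : ℕ} (lam : ℝ) (L : Fin N → W m p →ₗ[ℝ] ℝ) (ρ : Fin N → ℝ → ℝ)
    (y : Fin N → ℝ) (f : W m p) : ℝ :=
  lam / p * (∫ t in (0 : ℝ)..1, |D m f t| ^ p) + ∑ i, ρ i (L i f - y i)

/-- `a` is a subgradient of `r : ℝ → ℝ` at `z`. -/
def IsSubgradientAt (r : ℝ → ℝ) (a z : ℝ) : Prop :=
  ∀ w : ℝ, r z + a * (w - z) ≤ r w

/-- An open set `U ⊆ (0,1)` on which `|f^{(ℓ)}| > 0`, everywhere if `ℓ < m` (where `f^{(ℓ)}` is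
continuous) and almost everywhere if `ℓ = m` (where it is only an `L_p` function). -/
def IsNonvanishingRegion {m : ℕ} {p : ℝ} (ℓ : ℕ) (f : W m p) (U : Set ℝ) : Prop :=
  IsOpen U ∧ U ⊆ Ioo 0 1 ∧
    (ℓ < m → ∀ t ∈ U, 0 < |D ℓ f t|) ∧
    (ℓ = m → ∀ᵐ t ∂(volume.restrict U), 0 < |D ℓ f t|)

/-- The pairing `⟨d^m[u], φ⟩ = (-1)^m ∫_0^1 u φ^{(m)}` of the `m`-th distributional derivative of
`u` with a test function `φ` on `(0,1)`. -/
def distDeriv (m : ℕ) (u φ : ℝ → ℝ) : ℝ :=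
  (-1) ^ m * ∫ t in (0 : ℝ)..1, u t * iteratedDeriv m φ t

/-- The equation `(-1)^m λ d^m[|f^{(m)}|^{p-2} f^{(m)}] + ∑_i a_i h_i = 0` in the sense of
distributions on the open set `U ⊆ (0,1)`, where `h_i` is the distribution `φ ↦ L_i φ`. -/
def EulerLagrangeOn {m : ℕ} {p : ℝ} {N : ℕ} (lam : ℝ) (L : Fin N → W m p →ₗ[ℝ] ℝ)
    (a : Fin N → ℝ) (f : W m p) (U : Set ℝ) : Prop :=
  ∀ (φ : ℝ → ℝ) (hφ : ContDiff ℝ ∞ φ), HasCompactSupport φ → tsupport φ ⊆ U →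
    (-1) ^ m * lam * distDeriv m (fun t => |D m f t| ^ (p - 2) * D m f t) φ
      + ∑ i, a i * L i (ofSmooth m p φ hφ) = 0

end

end RobustSpline

open RobustSpline

namespace RobustSpline

noncomputable section

/-! Everything rests on the midpoint gap of `VP`: the mean of two values minus the value at the
midpoint. By `VP_midpoint` it splits into the gap of the energy `∫ |f^{(m)}|^p` and the gaps of the
`ρ_i`, all nonnegative. By `energy_sub_le`, a form of uniform convexity of `L_p`, a small energy gap
between functions of bounded energy forces their `m`-th derivatives to be close in `L_p`.

Uniqueness: the cone is convex, so two minimizers have gap zero. Hence they have the same `m`-th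
derivative a.e. and, by strict convexity of the `ρ_i`, the same values under every `L_i`. Their
difference is a polynomial of degree below `m` killed by all `L_i`, so it is zero. Existence: along
a minimizing sequence the gaps tend to zero, so the `m`-th derivatives are Cauchy in norm and no
weak compactness is needed. Coercivity bounds the values of the `L_i`, a subsequence of these
converges, and separation of polynomials recovers the Taylor part (`exists_limit`).

Euler–Lagrange: a Hahn–Banach separation in `ℝ × ℝ^N` replaces the possibly nonsmooth `ρ_i` by
linear terms with subgradient slopes `a_i` (`exists_subgradient_multipliers`). The resulting
functional is differentiable along lines, so its derivative vanishes in each direction `ψ` for which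
`f + s ψ` stays in the cone for all small `s` of both signs. If `ℓ < m`, test functions supported in
`U` are such directions, by compactness. If `ℓ = m`, `|f^{(m)}|` need not be bounded away from zero,
so the `m`-th derivative of the test function is truncated by multiples of `|f^{(m)}|` and a limit
is taken. -/

/-- Lebesgue measure on `[0,1]`. -/
abbrev unitMeasure : Measure ℝ := volume.restrict (Icc (0 : ℝ) 1)

theorem integral_zero_one_eq (u : ℝ → ℝ) : ∫ t in (0 : ℝ)..1, u t = ∫ t, u t ∂unitMeasure := by
  rw [intervalIntegral.integral_of_le zero_le_one, unitMeasure, integral_Icc_eq_integral_Ioc]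

theorem D_succ (j : ℕ) (f : I → ℝ) :
    D (j + 1) f = derivWithin (D j f) (Icc (0 : ℝ) 1) :=
  iteratedDerivWithin_succ

/-! ### Fundamental theorem of calculus in `W_{m,p}` -/

section

variable {m : ℕ} {p : ℝ} {f : I → ℝ} {j : ℕ}

theorem D_succ_eq_deriv {t : ℝ} (ht : t ∈ Ioo (0 : ℝ) 1) : D (j + 1) f t = deriv (D j f) t := by
  rw [D_succ, derivWithin_of_mem_nhds (Icc_mem_nhds ht.1 ht.2)]

theorem intervalIntegrable_D_succ (hf : MemW m p f) (hj : j < m) {t : ℝ}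
    (ht : t ∈ Icc (0 : ℝ) 1) : IntervalIntegrable (D (j + 1) f) volume 0 t := by
  have h1 : IntervalIntegrable (D (j + 1) f) volume 0 1 := by
    refine (hf.absCont j hj).intervalIntegrable_deriv.congr_ae ?_
    rw [uIoc_of_le zero_le_one, ← restrict_Ioo_eq_restrict_Ioc]
    exact (ae_restrict_mem measurableSet_Ioo).mono fun s hs => (D_succ_eq_deriv hs).symm
  refine h1.mono_set ?_
  rw [uIcc_of_le ht.1, uIcc_of_le zero_le_one]
  exact Icc_subset_Icc_right ht.2

theorem integral_D_succ (hf : MemW m p f) (hj : j < m) {t : ℝ} (ht : t ∈ Icc (0 : ℝ) 1) :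
    ∫ s in (0 : ℝ)..t, D (j + 1) f s = D j f t - D j f 0 := by
  have hac : AbsolutelyContinuousOnInterval (D j f) 0 t := (hf.absCont j hj).mono <| by
    rw [uIcc_of_le ht.1, uIcc_of_le zero_le_one]
    exact Icc_subset_Icc_right ht.2
  rw [← hac.integral_deriv_eq_sub, intervalIntegral.integral_of_le ht.1,
    intervalIntegral.integral_of_le ht.1, ← restrict_Ioo_eq_restrict_Ioc]
  exact setIntegral_congr_fun measurableSet_Ioo fun s hs =>
    D_succ_eq_deriv ⟨hs.1, hs.2.trans_le ht.2⟩

/-- Each integration from `0` to `t ≤ 1` multiplies a uniform bound by at most one, so the `L_1`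
bound from the innermost integration survives all later ones. -/
theorem abs_D_le_integral (hf : MemW m p f) (h0 : ∀ j < m, D j f 0 = 0) (hj : j < m) {t : ℝ}
    (ht : t ∈ Icc (0 : ℝ) 1) : |D j f t| ≤ ∫ s in (0 : ℝ)..1, |D m f s| := by
  obtain ⟨k, rfl⟩ := Nat.exists_eq_add_of_lt hj
  induction k generalizing j t with
  | zero =>
    have h := integral_D_succ hf hj ht
    rw [h0 j hj, sub_zero] at h
    rw [← h]
    refine (intervalIntegral.abs_integral_le_integral_abs ht.1).trans ?_
    exact intervalIntegral.integral_mono_interval le_rfl ht.1 ht.2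
      (Eventually.of_forall fun s => abs_nonneg _)
      (intervalIntegrable_D_succ hf hj (right_mem_Icc.2 zero_le_one)).abs
  | succ k ih =>
    have h := integral_D_succ hf hj ht
    rw [h0 j hj, sub_zero] at h
    rw [← h]
    have e : j + (k + 1) + 1 = (j + 1) + k + 1 := by ring
    rw [e] at hf h0 ⊢
    have hb := intervalIntegral.norm_integral_le_of_norm_le_const (a := 0) (b := t)
      (f := D (j + 1) f) (C := ∫ s in (0 : ℝ)..1, |D (j + 1 + k + 1) f s|) fun s hs => by
        rw [uIoc_of_le ht.1] at hs
        exact ih ⟨hs.1.le, hs.2.trans ht.2⟩ hf h0 (by omega)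
    rw [Real.norm_eq_abs, sub_zero, abs_of_nonneg ht.1] at hb
    refine hb.trans (mul_le_of_le_one_right ?_ ht.2)
    exact intervalIntegral.integral_nonneg zero_le_one fun s _ => abs_nonneg _

end

/-! ### Functions with a prescribed `m`-th derivative -/

/-- The `k`-fold iterated integral of `u` from `0`. -/
def iteratedIntegral (u : ℝ → ℝ) : ℕ → ℝ → ℝ
  | 0 => u
  | k + 1 => fun t => ∫ s in (0 : ℝ)..t, iteratedIntegral u k s

section

variable {u : ℝ → ℝ}

theorem intervalIntegrable_iteratedIntegral (hu : Integrable u) (k : ℕ) (a b : ℝ) :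
    IntervalIntegrable (iteratedIntegral u k) volume a b := by
  induction k generalizing a b with
  | zero => exact hu.intervalIntegrable
  | succ k ih => exact (intervalIntegral.continuous_primitive ih 0).intervalIntegrable a b

theorem continuous_iteratedIntegral (hu : Integrable u) (k : ℕ) :
    Continuous (iteratedIntegral u (k + 1)) :=
  intervalIntegral.continuous_primitive (intervalIntegrable_iteratedIntegral hu k) 0

theorem hasDerivAt_iteratedIntegral (hu : Integrable u) (k : ℕ) (t : ℝ) :
    HasDerivAt (iteratedIntegral u (k + 2)) (iteratedIntegral u (k + 1) t) t :=
  ((continuous_iteratedIntegral hu k).integral_hasStrictDerivAt 0 t).hasDerivAt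

theorem deriv_iteratedIntegral (hu : Integrable u) (k : ℕ) :
    deriv (iteratedIntegral u (k + 2)) = iteratedIntegral u (k + 1) :=
  funext fun t => (hasDerivAt_iteratedIntegral hu k t).deriv

theorem contDiff_iteratedIntegral (hu : Integrable u) (k : ℕ) :
    ContDiff ℝ k (iteratedIntegral u (k + 1)) := by
  induction k with
  | zero => exact contDiff_zero.2 (continuous_iteratedIntegral hu 0)
  | succ k ih =>
    rw [Nat.cast_succ]
    refine contDiff_succ_iff_deriv.2
      ⟨fun t => (hasDerivAt_iteratedIntegral hu k t).differentiableAt, ?_, ?_⟩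
    · intro h
      exact absurd h (by simp)
    · rwa [deriv_iteratedIntegral hu]

theorem iteratedDeriv_iteratedIntegral (hu : Integrable u) (j k : ℕ) :
    iteratedDeriv j (iteratedIntegral u (k + j + 1)) = iteratedIntegral u (k + 1) := by
  induction j with
  | zero => simp
  | succ j ih =>
    rw [iteratedDeriv_succ', show k + (j + 1) + 1 = k + j + 2 by ring,
      deriv_iteratedIntegral hu, ih]

/-- At least one integration remains after differentiating, which keeps the result continuous and
the identity valid at every point, endpoints included. Removing the last integration is possible
only almost everywhere, by Lebesgue differentiation. -/
theorem D_iteratedIntegral (hu : Integrable u) (j k : ℕ) :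
    EqOn (D j (fun t : I => iteratedIntegral u (k + j + 1) t)) (iteratedIntegral u (k + 1))
      (Icc (0 : ℝ) 1) := by
  intro t ht
  have h : EqOn (IccExtend zero_le_one (fun t : I => iteratedIntegral u (k + j + 1) t))
      (iteratedIntegral u (k + j + 1)) (Icc (0 : ℝ) 1) := fun s hs => by
    rw [IccExtend_of_mem _ _ hs]
  rw [D, iteratedDerivWithin_congr h ht,
    iteratedDerivWithin_eq_iteratedDeriv (uniqueDiffOn_Icc zero_lt_one) _ ht,
    iteratedDeriv_iteratedIntegral hu]
  exact ((contDiff_iteratedIntegral hu (k + j)).of_le (by exact_mod_cast Nat.le_add_left j k)).contDiffAt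

theorem D_top_iteratedIntegral (hu : Integrable u) (k : ℕ) :
    D (k + 1) (fun t : I => iteratedIntegral u (k + 1) t) =ᵐ[unitMeasure] u := by
  have h1 := (hu.intervalIntegrable (a := 0) (b := 1)).ae_hasDerivAt_integral
  have h2 : ∀ᵐ t ∂unitMeasure, t ∈ Ioo (0 : ℝ) 1 := by
    rw [unitMeasure, ← restrict_Ioo_eq_restrict_Icc]
    exact ae_restrict_mem measurableSet_Ioo
  filter_upwards [ae_restrict_of_ae h1, h2] with t ht hI
  have hI' := Ioo_subset_Icc_self hI
  rw [uIcc_of_le zero_le_one] at ht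
  have hE := D_iteratedIntegral hu k 0
  simp only [zero_add] at hE
  rw [D_succ, derivWithin_congr hE (hE hI'), derivWithin_of_mem_nhds (Icc_mem_nhds hI.1 hI.2)]
  exact (ht hI' 0 (left_mem_Icc.2 zero_le_one)).deriv

theorem iteratedIntegral_succ_zero (k : ℕ) : iteratedIntegral u (k + 1) 0 = 0 := by
  simp [iteratedIntegral]

/-- Every `u ∈ L_p[0,1]` is the `m`-th derivative of some `g ∈ W_{m,p}` whose lower derivatives
vanish at `0`. -/
theorem exists_primitive {m : ℕ} (hm : 1 ≤ m) {p : ℝ} (hp : 1 ≤ p)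
    (hu : MemLp u (ENNReal.ofReal p) unitMeasure) :
    ∃ g : W m p, (∀ j < m, D j g 0 = 0) ∧ D m g =ᵐ[unitMeasure] u := by
  obtain ⟨n, rfl⟩ : ∃ n, m = n + 1 := ⟨m - 1, by omega⟩
  -- Extension by zero makes the function integrable on the whole line, so that its iterated
  -- integrals are defined everywhere.
  set v := (Icc (0 : ℝ) 1).indicator u
  have hv : Integrable v := by
    rw [integrable_indicator_iff measurableSet_Icc]
    exact hu.integrable (by simpa using hp)
  have hvu : v =ᵐ[unitMeasure] u :=
    (ae_restrict_mem measurableSet_Icc).mono fun t ht => indicator_of_mem ht u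
  have hE : ∀ j < n + 1, EqOn (D j (fun t : I => iteratedIntegral v (n + 1) t))
      (iteratedIntegral v (n - j + 1)) (Icc (0 : ℝ) 1) := fun j hj => by
    have := D_iteratedIntegral hv j (n - j)
    rwa [show n - j + j + 1 = n + 1 by omega] at this
  have htop := (D_top_iteratedIntegral hv n).trans hvu
  refine ⟨⟨fun t => iteratedIntegral v (n + 1) t, ⟨?_, ?_, ?_⟩⟩, ?_, ?_⟩
  · refine ContDiffOn.congr (f := iteratedIntegral v (n + 1)) ?_ fun s hs => ?_
    · exact (contDiff_iteratedIntegral hv n).contDiffOn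
    · rw [IccExtend_of_mem _ _ hs]
  · intro j hj
    refine absCont_congr ?_ (hE j hj)
    exact (intervalIntegrable_iteratedIntegral hv _ 0 1).absolutelyContinuousOnInterval_intervalIntegral
      left_mem_uIcc
  · exact (memLp_congr_ae htop).2 hu
  · intro j hj
    change D j (fun t : I => iteratedIntegral v (n + 1) t) 0 = 0
    rw [hE j hj (left_mem_Icc.2 zero_le_one), iteratedIntegral_succ_zero]
  · exact htop

end

/-! ### Taylor polynomials and linearity of the derivatives -/

section

variable {m : ℕ} {p : ℝ}

theorem D_poly (c : Fin m → ℝ) (j : ℕ) {t : ℝ} (ht : t ∈ Icc (0 : ℝ) 1) :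
    D j (poly m p c) t
      = ∑ k : Fin m, c k * (((k : ℕ).descFactorial j : ℝ) * t ^ ((k : ℕ) - j)) := by
  have h := D_restrict (g := fun t => ∑ k : Fin m, c k * t ^ (k : ℕ)) (by fun_prop) j ht
  refine h.trans ?_
  rw [iteratedDeriv_fun_sum fun k _ => by fun_prop]
  exact Finset.sum_congr rfl fun k _ => by rw [iteratedDeriv_const_mul_field, iteratedDeriv_pow]

theorem D_poly_zero (c : Fin m → ℝ) (j : Fin m) :
    D j (poly m p c) 0 = (Nat.factorial j : ℝ) * c j := by
  rw [D_poly c j (left_mem_Icc.2 zero_le_one), Finset.sum_eq_single j]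
  · rw [Nat.descFactorial_self, Nat.sub_self, pow_zero, mul_one, mul_comm]
  · intro k _ hk
    rcases lt_or_gt_of_ne (fun h => hk (Fin.ext h) : (k : ℕ) ≠ j) with h | h
    · rw [Nat.descFactorial_of_lt h]; simp
    · rw [zero_pow (by omega)]; simp
  · simp

theorem D_poly_top (c : Fin m → ℝ) {t : ℝ} (ht : t ∈ Icc (0 : ℝ) 1) :
    D m (poly m p c) t = 0 := by
  rw [D_poly c m ht]
  exact Finset.sum_eq_zero fun k _ => by rw [Nat.descFactorial_of_lt k.2]; simp

theorem D_add_apply (f g : W m p) {j : ℕ} (hj : j < m) {t : ℝ} (ht : t ∈ Icc (0 : ℝ) 1) :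
    D j (f + g : W m p) t = D j f t + D j g t :=
  D_add_eqOn f.2 g.2 hj ht

theorem D_smul_apply (c : ℝ) (f : W m p) (j : ℕ) (t : ℝ) :
    D j (c • f : W m p) t = c * D j f t :=
  congrFun (D_smul j c (f : I → ℝ)) t

theorem D_sub_apply (f g : W m p) {j : ℕ} (hj : j < m) {t : ℝ} (ht : t ∈ Icc (0 : ℝ) 1) :
    D j (f - g : W m p) t = D j f t - D j g t := by
  rw [sub_eq_add_neg, ← neg_one_smul ℝ g, D_add_apply _ _ hj ht, D_smul_apply]
  ring

theorem D_top_add (f g : W m p) :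
    D m (f + g : W m p) =ᵐ[unitMeasure] fun t => D m f t + D m g t :=
  D_add_ae f.2 g.2

theorem D_top_sub (f g : W m p) :
    D m (f - g : W m p) =ᵐ[unitMeasure] fun t => D m f t - D m g t := by
  rw [sub_eq_add_neg]
  filter_upwards [D_top_add f (-g)] with t ht
  rw [ht, ← neg_one_smul ℝ g, D_smul_apply]
  ring

/-- The Taylor coefficients of `f` at `0`. -/
def taylorCoeff (f : W m p) : Fin m → ℝ := fun k => D k f 0 / (Nat.factorial k : ℝ)

theorem D_sub_taylor_zero (f : W m p) {j : ℕ} (hj : j < m) :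
    D j (f - poly m p (taylorCoeff f) : W m p) 0 = 0 := by
  rw [D_sub_apply _ _ hj (left_mem_Icc.2 zero_le_one), D_poly_zero _ ⟨j, hj⟩, taylorCoeff,
    mul_div_cancel₀ _ (by positivity), sub_self]

theorem D_sub_poly_top (f : W m p) (c : Fin m → ℝ) :
    D m (f - poly m p c : W m p) =ᵐ[unitMeasure] D m f := by
  filter_upwards [D_top_sub f (poly m p c), ae_restrict_mem measurableSet_Icc] with t h ht
  rw [h, D_poly_top c ht, sub_zero]

theorem poly_apply (c : Fin m → ℝ) (t : I) :
    (poly m p c : I → ℝ) t = ∑ k : Fin m, c k * (t : ℝ) ^ (k : ℕ) := rfl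

/-- `poly` as a linear map. -/
def polyₗ (m : ℕ) (p : ℝ) : (Fin m → ℝ) →ₗ[ℝ] W m p where
  toFun := poly m p
  map_add' c d := Subtype.ext <| funext fun t => by
    simp only [Submodule.coe_add, Pi.add_apply, poly_apply, add_mul, Finset.sum_add_distrib]
  map_smul' a c := Subtype.ext <| funext fun t => by
    simp only [Submodule.coe_smul, Pi.smul_apply, poly_apply, smul_eq_mul, Finset.mul_sum,
      RingHom.id_apply, mul_assoc]

theorem D_zero_apply (f : I → ℝ) (t : I) : D 0 f t = f t := by
  simp [D]

/-- An element of `W_{m,p}` with vanishing derivatives at `0` and vanishing `m`-th derivative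
is zero. -/
theorem eq_zero_of_D (hm : 1 ≤ m) (f : W m p) (h0 : ∀ j < m, D j f 0 = 0)
    (h : D m f =ᵐ[unitMeasure] 0) : f = 0 := by
  refine Subtype.ext (funext fun t => ?_)
  have hb := abs_D_le_integral f.2 h0 hm t.2
  rw [integral_zero_one_eq, integral_congr_ae (g := fun _ => (0 : ℝ))
    (h.mono fun s hs => by simp [hs]), integral_zero, D_zero_apply] at hb
  exact abs_nonpos_iff.1 hb

theorem normW_of_D_zero (hp : 0 < p) (f : W m p) (h0 : ∀ j < m, D j f 0 = 0) :
    normW f = (∫ t in (0 : ℝ)..1, |D m f t| ^ p) ^ (1 / p) := by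
  rw [normW, Finset.sum_eq_zero fun j hj => ?_, zero_add]
  rw [h0 j (Finset.mem_range.1 hj), abs_zero, Real.zero_rpow hp.ne']

theorem integrable_abs_rpow {u : ℝ → ℝ} (hp : 0 < p)
    (hu : MemLp u (ENNReal.ofReal p) unitMeasure) :
    Integrable (fun t => |u t| ^ p) unitMeasure := by
  have := hu.integrable_norm_rpow (by simpa using hp) ENNReal.ofReal_ne_top
  simpa [ENNReal.toReal_ofReal hp.le] using this

end

/-! ### Uniform convexity of the `p`-th power -/

/-- The convexity gap of `|·|^p` at the midpoint. -/
def powGap (p a b : ℝ) : ℝ := (|a| ^ p + |b| ^ p) / 2 - |(a + b) / 2| ^ p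

/-- If the absolute values differ, strict convexity of the power on `[0,∞)` and the triangle
inequality suffice. If they agree, then `a = -b` and the midpoint is zero. -/
theorem powGap_pos {p : ℝ} (hp : 1 < p) {a b : ℝ} (hab : a ≠ b) : 0 < powGap p a b := by
  have hp0 : 0 < p := by linarith
  rw [powGap, sub_pos]
  by_cases h : |a| = |b|
  · have hb : a = -b := (abs_eq_abs.1 h).resolve_left hab
    have hb0 : b ≠ 0 := fun h0 => hab (by rw [hb, h0, neg_zero])
    have := Real.rpow_pos_of_pos (abs_pos.2 hb0) p
    rw [hb, neg_add_cancel, zero_div, abs_zero, Real.zero_rpow hp0.ne', abs_neg]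
    linarith
  · have h1 := (strictConvexOn_rpow hp).2 (abs_nonneg a) (abs_nonneg b) h
      (by norm_num : (0 : ℝ) < 1 / 2) (by norm_num : (0 : ℝ) < 1 / 2) (by norm_num)
    simp only [smul_eq_mul] at h1
    have h2 : |(a + b) / 2| ^ p ≤ (1 / 2 * |a| + 1 / 2 * |b|) ^ p := by
      refine Real.rpow_le_rpow (abs_nonneg _) ?_ hp0.le
      rw [abs_div, abs_two]
      linarith [abs_add_le a b]
    linarith

theorem powGap_self {p : ℝ} (a : ℝ) : powGap p a a = 0 := by
  rw [powGap, add_self_div_two, add_self_div_two, sub_self]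

theorem powGap_nonneg {p : ℝ} (hp : 1 < p) (a b : ℝ) : 0 ≤ powGap p a b := by
  by_cases hab : a = b
  · rw [hab, powGap_self]
  · exact (powGap_pos hp hab).le

theorem continuous_abs_rpow {p : ℝ} (hp : 0 < p) : Continuous fun a : ℝ => |a| ^ p :=
  continuous_abs.rpow_const fun _ => Or.inr hp.le

theorem continuous_powGap {p : ℝ} (hp : 0 < p) :
    Continuous fun z : ℝ × ℝ => powGap p z.1 z.2 := by
  have h := continuous_abs_rpow hp
  exact (((h.comp continuous_fst).add (h.comp continuous_snd)).div_const 2).sub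
    (h.comp ((continuous_fst.add continuous_snd).div_const 2))

theorem powGap_mul {p r : ℝ} (hr : 0 ≤ r) (a b : ℝ) :
    powGap p (r * a) (r * b) = r ^ p * powGap p a b := by
  rw [powGap, powGap, ← mul_add, mul_div_assoc, abs_mul, abs_mul, abs_mul, abs_of_nonneg hr,
    Real.mul_rpow hr (abs_nonneg _), Real.mul_rpow hr (abs_nonneg _),
    Real.mul_rpow hr (abs_nonneg _)]
  ring

/-- A quantitative form of the uniform convexity of `L_p`. -/
theorem exists_abs_sub_rpow_le {p : ℝ} (hp : 1 < p) {ε : ℝ} (hε : 0 < ε) :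
    ∃ C : ℝ, 0 ≤ C ∧ ∀ a b : ℝ, |a - b| ^ p ≤ ε * (|a| ^ p + |b| ^ p) + C * powGap p a b := by
  have hp0 : 0 < p := by linarith
  have hsub : Continuous fun z : ℝ × ℝ => |z.1 - z.2| ^ p :=
    (continuous_abs_rpow hp0).comp (continuous_fst.sub continuous_snd)
  -- By homogeneity it is enough to work on the unit sphere. Its part away from the diagonal is
  -- compact, so the gap has a positive lower bound `δ` there and the gap term absorbs `2 ^ p`; on
  -- the rest of the sphere the `ε` term suffices.
  set S : Set (ℝ × ℝ) := Metric.sphere 0 1 ∩ {z | ε ≤ |z.1 - z.2| ^ p} with hS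
  have hSc : IsCompact S :=
    (isCompact_sphere 0 1).inter_right (isClosed_le continuous_const hsub)
  obtain ⟨δ, hδ, hδS⟩ : ∃ δ : ℝ, 0 < δ ∧ ∀ z ∈ S, δ ≤ powGap p z.1 z.2 := by
    rcases S.eq_empty_or_nonempty with h | h
    · exact ⟨1, one_pos, by simp [h]⟩
    · obtain ⟨z, hz, hmin⟩ := hSc.exists_isMinOn h (continuous_powGap hp0).continuousOn
      refine ⟨powGap p z.1 z.2, powGap_pos hp fun h => ?_, fun w hw => hmin hw⟩
      have := hz.2
      rw [mem_ofPred_eq, h, sub_self, abs_zero, Real.zero_rpow hp0.ne'] at this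
      linarith
  have hsphere : ∀ z : ℝ × ℝ, ‖z‖ = 1 →
      |z.1 - z.2| ^ p ≤ ε * (|z.1| ^ p + |z.2| ^ p) + 2 ^ p / δ * powGap p z.1 z.2 := by
    intro z hz
    have hz1 : |z.1| ≤ 1 := (norm_fst_le z).trans hz.le
    have hz2 : |z.2| ≤ 1 := (norm_snd_le z).trans hz.le
    have hn1 := Real.rpow_nonneg (abs_nonneg z.1) p
    have hn2 := Real.rpow_nonneg (abs_nonneg z.2) p
    have hg := powGap_nonneg hp z.1 z.2
    by_cases h : ε ≤ |z.1 - z.2| ^ p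
    · have h1 : |z.1 - z.2| ^ p ≤ 2 ^ p := by
        refine Real.rpow_le_rpow (abs_nonneg _) ?_ hp0.le
        linarith [abs_sub z.1 z.2]
      have h2 : (2 : ℝ) ^ p ≤ 2 ^ p / δ * powGap p z.1 z.2 := by
        rw [div_mul_eq_mul_div, le_div_iff₀ hδ]
        exact mul_le_mul_of_nonneg_left (hδS z ⟨by simpa using hz, h⟩) (by positivity)
      have : 0 ≤ ε * (|z.1| ^ p + |z.2| ^ p) := by positivity
      linarith
    -- The norm on the product is the maximum, so one coordinate has absolute value one.
    · have h1 : 1 ≤ |z.1| ^ p + |z.2| ^ p := by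
        rw [Prod.norm_def] at hz
        rcases max_choice ‖z.1‖ ‖z.2‖ with h' | h' <;> rw [h', Real.norm_eq_abs] at hz <;>
          rw [hz, Real.one_rpow] <;> linarith
      have h2 : 0 ≤ 2 ^ p / δ * powGap p z.1 z.2 := by positivity
      nlinarith
  refine ⟨2 ^ p / δ, by positivity, fun a b => ?_⟩
  rcases eq_or_ne ((a, b) : ℝ × ℝ) 0 with h0 | h0
  · obtain ⟨rfl, rfl⟩ := Prod.mk_eq_zero.1 h0
    simp [powGap_self, Real.zero_rpow hp0.ne']
  · set r := ‖((a, b) : ℝ × ℝ)‖ with hr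
    have hr0 : 0 < r := norm_pos_iff.2 h0
    have h1 := hsphere (r⁻¹ • (a, b)) (by
      rw [norm_smul, norm_inv, norm_norm, inv_mul_cancel₀ hr0.ne'])
    simp only [Prod.smul_mk, smul_eq_mul] at h1
    rw [powGap_mul (inv_nonneg.2 hr0.le), ← mul_sub, abs_mul, abs_mul, abs_mul,
      abs_of_nonneg (inv_nonneg.2 hr0.le), Real.mul_rpow (inv_nonneg.2 hr0.le) (abs_nonneg _),
      Real.mul_rpow (inv_nonneg.2 hr0.le) (abs_nonneg _),
      Real.mul_rpow (inv_nonneg.2 hr0.le) (abs_nonneg _)] at h1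
    have h2 : 0 < r⁻¹ ^ p := Real.rpow_pos_of_pos (inv_pos.2 hr0) p
    refine le_of_mul_le_mul_left (h1.trans_eq ?_) h2
    ring

theorem StrictConvexOn.midpoint_nonneg {r : ℝ → ℝ} (hr : StrictConvexOn ℝ univ r) (a b : ℝ) :
    0 ≤ (r a + r b) / 2 - r ((a + b) / 2) := by
  have h := hr.convexOn.2 (mem_univ a) (mem_univ b) (by norm_num : (0 : ℝ) ≤ 1 / 2)
    (by norm_num : (0 : ℝ) ≤ 1 / 2) (by norm_num)
  simp only [smul_eq_mul, ← mul_add] at h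
  rw [one_div_mul_eq_div, one_div_mul_eq_div] at h
  linarith

theorem StrictConvexOn.midpoint_pos {r : ℝ → ℝ} (hr : StrictConvexOn ℝ univ r) {a b : ℝ}
    (hab : a ≠ b) : 0 < (r a + r b) / 2 - r ((a + b) / 2) := by
  have h := hr.2 (mem_univ a) (mem_univ b) hab (by norm_num : (0 : ℝ) < 1 / 2)
    (by norm_num : (0 : ℝ) < 1 / 2) (by norm_num)
  simp only [smul_eq_mul, ← mul_add] at h
  rw [one_div_mul_eq_div, one_div_mul_eq_div] at h
  linarith

/-! ### The cone, the energy and uniqueness -/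

section

variable {m : ℕ} {p : ℝ} {ℓ K : ℕ} {x : Fin K → ℝ}

theorem knots_mem (hx01 : ∀ k, x k ∈ Icc (0 : ℝ) 1) (j : Fin (K + 2)) :
    knots x j ∈ Icc (0 : ℝ) 1 := by
  rw [knots]
  induction j using Fin.cases with
  | zero => simp
  | succ j =>
    induction j using Fin.lastCases with
    | last => simp
    | cast j => simpa using hx01 j

theorem Icc_knots_subset (hx01 : ∀ k, x k ∈ Icc (0 : ℝ) 1) (i j : Fin (K + 2)) :
    Icc (knots x i) (knots x j) ⊆ Icc (0 : ℝ) 1 :=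
  Icc_subset_Icc (knots_mem hx01 i).1 (knots_mem hx01 j).2

theorem ae_Icc_knots (hx01 : ∀ k, x k ∈ Icc (0 : ℝ) 1) (i j : Fin (K + 2)) {q : ℝ → Prop}
    (h : ∀ᵐ t ∂unitMeasure, q t) :
    ∀ᵐ t ∂(volume.restrict (Icc (knots x i) (knots x j))), q t :=
  ae_restrict_of_ae_restrict_of_subset (Icc_knots_subset hx01 i j) h

theorem zero_mem_cone : (0 : W m p) ∈ cone ℓ m p x := by
  have h : ∀ j t, D j ((0 : W m p) : I → ℝ) t = 0 := fun j t => by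
    rw [← zero_smul ℝ (0 : W m p), D_smul_apply, zero_mul]
  exact fun j => ⟨fun _ t _ => by rw [h, mul_zero],
    fun _ => Eventually.of_forall fun t => by rw [h, mul_zero]⟩

theorem add_mem_cone (hx01 : ∀ k, x k ∈ Icc (0 : ℝ) 1) {f g : W m p}
    (hf : f ∈ cone ℓ m p x) (hg : g ∈ cone ℓ m p x) : f + g ∈ cone ℓ m p x := by
  refine fun j => ⟨fun h t ht => ?_, fun h => ?_⟩
  · rw [D_add_apply f g h (Icc_knots_subset hx01 _ _ ht), mul_add]
    exact add_nonneg ((hf j).1 h t ht) ((hg j).1 h t ht)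
  · subst h
    filter_upwards [(hf j).2 rfl, (hg j).2 rfl, ae_Icc_knots hx01 _ _ (D_top_add f g)]
      with t h1 h2 h3
    rw [h3, mul_add]
    exact add_nonneg h1 h2

theorem smul_mem_cone {f : W m p} (hf : f ∈ cone ℓ m p x) {c : ℝ} (hc : 0 ≤ c) :
    c • f ∈ cone ℓ m p x := by
  refine fun j => ⟨fun h t ht => ?_, fun h => ?_⟩
  · rw [D_smul_apply, mul_left_comm]
    exact mul_nonneg hc ((hf j).1 h t ht)
  · filter_upwards [(hf j).2 h] with t ht
    rw [D_smul_apply, mul_left_comm]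
    exact mul_nonneg hc ht

theorem convex_cone (hx01 : ∀ k, x k ∈ Icc (0 : ℝ) 1) : Convex ℝ (cone ℓ m p x) :=
  fun _ hf _ hg _ _ ha hb _ => add_mem_cone hx01 (smul_mem_cone hf ha) (smul_mem_cone hg hb)

/-- The energy `∫_0^1 |f^{(m)}|^p`. -/
def energy (f : W m p) : ℝ := ∫ t, |D m f t| ^ p ∂unitMeasure

theorem energy_nonneg (f : W m p) : 0 ≤ energy f :=
  integral_nonneg fun _ => Real.rpow_nonneg (abs_nonneg _) _

theorem integrable_energy (hp : 0 < p) (f : W m p) :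
    Integrable (fun t => |D m f t| ^ p) unitMeasure :=
  integrable_abs_rpow hp f.2.memLp

theorem D_top_midpoint (f g : W m p) :
    D m ((1 / 2 : ℝ) • (f + g) : W m p) =ᵐ[unitMeasure] fun t => (D m f t + D m g t) / 2 := by
  filter_upwards [D_top_add f g] with t ht
  rw [D_smul_apply, ht]
  ring

theorem energy_midpoint (hp : 1 < p) (f g : W m p) :
    Integrable (fun t => powGap p (D m f t) (D m g t)) unitMeasure ∧
    (energy f + energy g) / 2 - energy ((1 / 2 : ℝ) • (f + g))
      = ∫ t, powGap p (D m f t) (D m g t) ∂unitMeasure := by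
  have hp0 : 0 < p := by linarith
  have hf := integrable_energy hp0 f
  have hg := integrable_energy hp0 g
  have hfg : Integrable (fun t => |D m f t| ^ p + |D m g t| ^ p) unitMeasure := hf.add hg
  have hm : Integrable (fun t => |(D m f t + D m g t) / 2| ^ p) unitMeasure :=
    (integrable_energy hp0 ((1 / 2 : ℝ) • (f + g))).congr
      ((D_top_midpoint f g).mono fun t ht => by simp only [ht])
  refine ⟨(hfg.div_const 2).sub hm, ?_⟩
  have e : energy ((1 / 2 : ℝ) • (f + g)) = ∫ t, |(D m f t + D m g t) / 2| ^ p ∂unitMeasure :=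
    integral_congr_ae ((D_top_midpoint f g).mono fun t ht => by simp only [ht])
  simp only [powGap]
  rw [integral_sub (hfg.div_const 2) hm, integral_div, integral_add hf hg, e]
  rfl

/-- This integrates the pointwise bound of `exists_abs_sub_rpow_le` and plays the role of Clarkson's
inequalities, uniformly over all `1 < p`. -/
theorem energy_sub_le (hp : 1 < p) {ε : ℝ} (hε : 0 < ε) : ∃ C : ℝ, 0 ≤ C ∧ ∀ f g : W m p,
    energy (f - g) ≤ ε * (energy f + energy g)
      + C * ((energy f + energy g) / 2 - energy ((1 / 2 : ℝ) • (f + g))) := by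
  have hp0 : 0 < p := by linarith
  obtain ⟨C, hC0, hC⟩ := exists_abs_sub_rpow_le hp hε
  refine ⟨C, hC0, fun f g => ?_⟩
  have hf := integrable_energy hp0 f
  have hg := integrable_energy hp0 g
  have hfg : Integrable (fun t => |D m f t| ^ p + |D m g t| ^ p) unitMeasure := hf.add hg
  obtain ⟨hi, he⟩ := energy_midpoint hp f g
  rw [he, energy, energy, energy, ← integral_add hf hg, ← integral_const_mul,
    ← integral_const_mul, ← integral_add (hfg.const_mul ε) (hi.const_mul C)]
  refine integral_mono_ae (integrable_energy hp0 (f - g))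
    ((hfg.const_mul ε).add (hi.const_mul C)) ?_
  filter_upwards [D_top_sub f g] with t ht
  simp only [ht]
  exact hC _ _

variable {N : ℕ} {lam : ℝ} {L : Fin N → W m p →ₗ[ℝ] ℝ} {ρ : Fin N → ℝ → ℝ} {y : Fin N → ℝ}

theorem VP_eq (f : W m p) : VP lam L ρ y f = lam / p * energy f + ∑ i, ρ i (L i f - y i) := by
  rw [VP, integral_zero_one_eq, energy]

theorem VP_midpoint (f g : W m p) :
    (VP lam L ρ y f + VP lam L ρ y g) / 2 - VP lam L ρ y ((1 / 2 : ℝ) • (f + g))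
      = lam / p * ((energy f + energy g) / 2 - energy ((1 / 2 : ℝ) • (f + g)))
        + ∑ i, ((ρ i (L i f - y i) + ρ i (L i g - y i)) / 2
          - ρ i (((L i f - y i) + (L i g - y i)) / 2)) := by
  have h : ∀ i, L i ((1 / 2 : ℝ) • (f + g)) - y i = ((L i f - y i) + (L i g - y i)) / 2 := by
    intro i
    rw [map_smul, map_add, smul_eq_mul]
    ring
  simp only [VP_eq, h, Finset.sum_sub_distrib, ← Finset.sum_div, Finset.sum_add_distrib]
  ring

theorem energy_gap_nonneg (hp : 1 < p) (f g : W m p) :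
    0 ≤ (energy f + energy g) / 2 - energy ((1 / 2 : ℝ) • (f + g)) := by
  rw [(energy_midpoint hp f g).2]
  exact integral_nonneg fun t => powGap_nonneg hp _ _

theorem D_top_eq_zero_of_energy (hp : 0 < p) {f : W m p} (h : energy f = 0) :
    D m f =ᵐ[unitMeasure] 0 := by
  rw [energy, integral_eq_zero_iff_of_nonneg
    (fun _ => Real.rpow_nonneg (abs_nonneg _) _) (integrable_energy hp f)] at h
  filter_upwards [h] with t ht
  exact abs_eq_zero.1 ((Real.rpow_eq_zero (abs_nonneg _) hp.ne').1 ht)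

theorem minimizer_unique (hm : 1 ≤ m) (hp : 1 < p) (hlam : 0 < lam)
    (hx01 : ∀ k, x k ∈ Icc (0 : ℝ) 1) (hsep : SeparatesPolynomials L)
    (hρ : ∀ i, StrictConvexOn ℝ univ (ρ i)) {f g : W m p}
    (hf : f ∈ cone ℓ m p x) (hg : g ∈ cone ℓ m p x)
    (hfmin : IsMinOn (VP lam L ρ y) (cone ℓ m p x) f)
    (hgmin : IsMinOn (VP lam L ρ y) (cone ℓ m p x) g) : f = g := by
  have hp0 : 0 < p := by linarith
  have hmid : (1 / 2 : ℝ) • (f + g) ∈ cone ℓ m p x :=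
    smul_mem_cone (add_mem_cone hx01 hf hg) (by norm_num)
  have h1 := hfmin hmid
  have h2 := hgmin hmid
  simp only [mem_ofPred_eq] at h1 h2
  have key := VP_midpoint (lam := lam) (L := L) (ρ := ρ) (y := y) f g
  have hE := energy_gap_nonneg hp f g
  have hR : ∀ i, 0 ≤ (ρ i (L i f - y i) + ρ i (L i g - y i)) / 2
      - ρ i (((L i f - y i) + (L i g - y i)) / 2) := fun i =>
    StrictConvexOn.midpoint_nonneg (hρ i) _ _
  have hlp : 0 < lam / p := div_pos hlam hp0
  have hS := Finset.sum_nonneg fun i (_ : i ∈ Finset.univ) => hR i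
  have hlE := mul_nonneg hlp.le hE
  -- The midpoint cannot beat either minimizer, so the total gap is at most zero and each of its
  -- nonnegative parts vanishes.
  have hE0 : (energy f + energy g) / 2 - energy ((1 / 2 : ℝ) • (f + g)) = 0 :=
    (mul_eq_zero.1 (le_antisymm (by linarith) hlE)).resolve_left hlp.ne'
  have hS0 := (Finset.sum_eq_zero_iff_of_nonneg fun i _ => hR i).1
    (le_antisymm (by linarith) hS)
  have hL : ∀ i, L i (f - g) = 0 := fun i => by
    by_contra hne
    rw [map_sub, sub_eq_zero] at hne
    have := StrictConvexOn.midpoint_pos (hρ i) (a := L i f - y i) (b := L i g - y i)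
      fun h => hne (sub_left_injective h)
    rw [hS0 i (Finset.mem_univ i)] at this
    exact this.false
  -- With zero gap the constant `C` drops out, and only the arbitrarily small first term of
  -- `energy_sub_le` is left.
  have hsub : energy (f - g) = 0 := by
    refine le_antisymm (le_of_forall_pos_le_add fun ε hε => ?_) (energy_nonneg _)
    have hs : 0 < energy f + energy g + 1 := by
      linarith [energy_nonneg f, energy_nonneg g]
    obtain ⟨C, -, hC⟩ := energy_sub_le (m := m) hp (div_pos hε hs)
    refine (hC f g).trans ?_
    rw [hE0, mul_zero, add_zero, zero_add, div_mul_eq_mul_div, div_le_iff₀ hs]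
    nlinarith
  have hD := D_top_eq_zero_of_energy hp0 hsub
  set c := taylorCoeff (f - g) with hc
  have h0 : f - g - poly m p c = 0 :=
    eq_zero_of_D hm _ (fun j hj => D_sub_taylor_zero (f - g) hj)
      ((D_sub_poly_top (f - g) c).trans hD)
  rw [sub_eq_zero] at h0
  have hc0 : c = 0 := hsep c fun i => by rw [← h0, hL]
  rw [hc0] at h0
  exact sub_eq_zero.1 (h0.trans (map_zero (polyₗ m p)))

end

/-! ### Convergence in `L_p` and existence -/

section

variable {m : ℕ} {p : ℝ}

/-- The `m`-th derivative as an element of `L_p[0,1]`. -/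
def topLp (f : W m p) : Lp ℝ (ENNReal.ofReal p) unitMeasure := f.2.memLp.toLp (D m f)

theorem coeFn_topLp (f : W m p) : topLp f =ᵐ[unitMeasure] D m f := MemLp.coeFn_toLp _

theorem topLp_sub (f g : W m p) : topLp (f - g) = topLp f - topLp g := by
  rw [topLp, topLp, topLp, ← MemLp.toLp_sub, MemLp.toLp_eq_toLp_iff]
  exact D_top_sub f g

theorem norm_topLp (hp : 0 < p) (f : W m p) : ‖topLp f‖ = energy f ^ (1 / p) := by
  rw [topLp, Lp.norm_toLp, f.2.memLp.eLpNorm_eq_integral_rpow_norm (by simpa using hp)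
    ENNReal.ofReal_ne_top, ENNReal.toReal_ofReal (by positivity), ENNReal.toReal_ofReal hp.le,
    one_div]
  rfl

theorem energy_eq_norm_rpow (hp : 0 < p) (f : W m p) : energy f = ‖topLp f‖ ^ p := by
  rw [norm_topLp hp, ← Real.rpow_mul (energy_nonneg f), one_div_mul_cancel hp.ne', Real.rpow_one]

theorem normW_eq_norm_topLp (hp : 0 < p) (f : W m p) (h0 : ∀ j < m, D j f 0 = 0) :
    normW f = ‖topLp f‖ := by
  rw [normW_of_D_zero hp f h0, norm_topLp hp, energy, integral_zero_one_eq]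

/-- On a probability space the `L_1` norm is at most the `L_p` norm. -/
theorem abs_D_le_norm_topLp (hp : 1 < p) (f : W m p) (h0 : ∀ j < m, D j f 0 = 0) {j : ℕ}
    (hj : j < m) {t : ℝ} (ht : t ∈ Icc (0 : ℝ) 1) : |D j f t| ≤ ‖topLp f‖ := by
  refine (abs_D_le_integral f.2 h0 hj ht).trans ?_
  have : IsProbabilityMeasure unitMeasure := ⟨by simp⟩
  have hp1 : (1 : ENNReal) ≤ ENNReal.ofReal p := by simpa using hp.le
  have hint : Integrable (D m f) unitMeasure := f.2.memLp.integrable hp1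
  rw [integral_zero_one_eq, topLp, Lp.norm_toLp]
  simp only [← Real.norm_eq_abs]
  rw [integral_norm_eq_lintegral_enorm hint.1, ← eLpNorm_one_eq_lintegral_enorm]
  exact ENNReal.toReal_mono f.2.memLp.eLpNorm_ne_top
    (eLpNorm_le_eLpNorm_of_exponent_le hp1 hint.1)

theorem tendsto_functional {L : W m p →ₗ[ℝ] ℝ} (hL : IsBoundedFunctional L) (hp : 0 < p)
    {h : ℕ → W m p} (h0 : ∀ n, ∀ j < m, D j (h n) 0 = 0)
    (hlim : Tendsto (fun n => ‖topLp (h n)‖) atTop (𝓝 0)) :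
    Tendsto (fun n => L (h n)) atTop (𝓝 0) := by
  obtain ⟨C, hC⟩ := hL
  refine squeeze_zero_norm (fun n => ?_) (by simpa using hlim.const_mul C)
  rw [← normW_eq_norm_topLp hp _ (h0 n)]
  exact hC _

theorem cauchySeq_topLp (hp : 1 < p) [Fact (1 ≤ ENNReal.ofReal p)] {f : ℕ → W m p} {M : ℝ}
    (hM : ∀ n, energy (f n) ≤ M) {δ : ℕ → ℝ} (hδ : Tendsto δ atTop (𝓝 0))
    (hgap : ∀ n k, (energy (f n) + energy (f k)) / 2 - energy ((1 / 2 : ℝ) • (f n + f k))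
      ≤ δ n + δ k) :
    CauchySeq fun n => topLp (f n) := by
  have hp0 : 0 < p := by linarith
  rw [Metric.cauchySeq_iff]
  intro η hη
  have hη' : 0 < η ^ p := Real.rpow_pos_of_pos hη p
  have hM0 : 0 ≤ M := (energy_nonneg (f 0)).trans (hM 0)
  -- The energies are at most `M`, so this choice keeps the first term below `η ^ p / 2`; the
  -- threshold `n₀` then makes the gap term at most `η ^ p / 2`.
  obtain ⟨C, hC0, hC⟩ := energy_sub_le (m := m) hp
    (ε := η ^ p / (4 * (M + 1))) (by positivity)
  obtain ⟨n₀, hn₀⟩ := eventually_atTop.1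
    (hδ.eventually (gt_mem_nhds (show 0 < η ^ p / (4 * (C + 1)) by positivity)))
  refine ⟨n₀, fun n hn k hk => ?_⟩
  rw [dist_eq_norm, ← topLp_sub]
  refine lt_of_not_ge fun hge => ?_
  have h1 : η ^ p ≤ energy (f n - f k) := by
    rw [energy_eq_norm_rpow hp0]
    exact Real.rpow_le_rpow hη.le hge hp0.le
  have h2 : η ^ p / (4 * (M + 1)) * (energy (f n) + energy (f k)) < η ^ p / 2 := by
    rw [div_mul_eq_mul_div, div_lt_div_iff₀ (by positivity) two_pos]
    nlinarith [hM n, hM k]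
  have h3 : C * (δ n + δ k) ≤ C * (η ^ p / (2 * (C + 1))) := by
    refine mul_le_mul_of_nonneg_left ?_ hC0
    have := hn₀ n hn
    have := hn₀ k hk
    have e : η ^ p / (2 * (C + 1)) = η ^ p / (4 * (C + 1)) + η ^ p / (4 * (C + 1)) := by
      field_simp; ring
    linarith
  have h4 : C * (η ^ p / (2 * (C + 1))) ≤ η ^ p / 2 := by
    rw [mul_div_assoc', div_le_div_iff₀ (by positivity) two_pos]
    nlinarith
  have h5 := mul_le_mul_of_nonneg_left (hgap n k) hC0
  linarith [hC (f n) (f k)]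

variable {ℓ K : ℕ} {x : Fin K → ℝ}

/-- Pointwise limits preserve signs. For `ℓ = m` there is only `L_p` convergence, and a subsequence
converging almost everywhere takes over. -/
theorem mem_cone_of_tendsto (hℓ : ℓ ≤ m) (hx01 : ∀ k, x k ∈ Icc (0 : ℝ) 1)
    [Fact (1 ≤ ENNReal.ofReal p)]
    {f : ℕ → W m p} {g : W m p} (hf : ∀ n, f n ∈ cone ℓ m p x)
    (hpt : ∀ j < m, ∀ t ∈ Icc (0 : ℝ) 1, Tendsto (fun n => D j (f n) t) atTop (𝓝 (D j g t)))
    (hLp : Tendsto (fun n => topLp (f n)) atTop (𝓝 (topLp g))) : g ∈ cone ℓ m p x := by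
  refine fun j => ⟨fun h t ht => ?_, fun h => ?_⟩
  · exact ge_of_tendsto' ((hpt ℓ h t (Icc_knots_subset hx01 _ _ ht)).const_mul _)
      fun n => (hf n j).1 h t ht
  · subst h
    obtain ⟨φ, -, hφ⟩ := (tendstoInMeasure_of_tendsto_Lp hLp).exists_seq_tendsto_ae
    have hall : ∀ᵐ t ∂unitMeasure, ∀ n, topLp (f n) t = D ℓ (f n) t :=
      ae_all_iff.2 fun n => coeFn_topLp (f n)
    filter_upwards [ae_Icc_knots hx01 j.castSucc j.succ hφ,
      ae_Icc_knots hx01 j.castSucc j.succ (coeFn_topLp g),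
      ae_Icc_knots hx01 j.castSucc j.succ hall,
      ae_all_iff.2 fun n => (hf n j).2 rfl] with t h1 h2 h3 h4
    rw [h2] at h1
    exact ge_of_tendsto' (h1.const_mul _) fun n => by rw [h3]; exact h4 _

variable {N : ℕ} {L : Fin N → W m p →ₗ[ℝ] ℝ}

/-- Sequences with convergent `m`-th derivatives in `L_p` and convergent values of the functionals
`L_i` converge. -/
theorem exists_limit (hm : 1 ≤ m) (hp : 1 < p) [Fact (1 ≤ ENNReal.ofReal p)]
    (hL : ∀ i, IsBoundedFunctional (L i)) (hsep : SeparatesPolynomials L)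
    {f : ℕ → W m p} {u : Lp ℝ (ENNReal.ofReal p) unitMeasure} {z : Fin N → ℝ}
    (hu : Tendsto (fun n => topLp (f n)) atTop (𝓝 u))
    (hz : Tendsto (fun n i => L i (f n)) atTop (𝓝 z)) :
    ∃ g : W m p, topLp g = u ∧ (∀ i, L i g = z i) ∧
      ∀ j < m, ∀ t ∈ Icc (0 : ℝ) 1, Tendsto (fun n => D j (f n) t) atTop (𝓝 (D j g t)) := by
  have hp0 : 0 < p := by linarith
  obtain ⟨g₀, hg₀, hg₀u⟩ := exists_primitive hm hp.le (Lp.memLp u)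
  set c : ℕ → Fin m → ℝ := fun n => taylorCoeff (f n) with hc
  -- Each `f n` is its Taylor polynomial plus the fixed primitive `g₀` plus a remainder that tends
  -- to zero in `W_{m,p}`.
  set h : ℕ → W m p := fun n => f n - poly m p (c n) - g₀ with hh
  have hf : ∀ n, f n = polyₗ m p (c n) + (g₀ + h n) := fun n => by
    simp only [hh, polyₗ, LinearMap.coe_mk, AddHom.coe_mk]
    abel
  have hh0 : ∀ n, ∀ j < m, D j (h n) 0 = 0 := fun n j hj => by
    rw [hh, D_sub_apply _ _ hj (left_mem_Icc.2 zero_le_one), hg₀ j hj, sub_zero]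
    exact D_sub_taylor_zero (f n) hj
  have hg₀L : topLp g₀ = u := Lp.ext ((coeFn_topLp g₀).trans hg₀u)
  have htop : ∀ (w : W m p) (b : Fin m → ℝ), topLp (w - poly m p b) = topLp w := fun w b =>
    Lp.ext ((coeFn_topLp _).trans ((D_sub_poly_top w b).trans (coeFn_topLp w).symm))
  have hh_lim : Tendsto (fun n => ‖topLp (h n)‖) atTop (𝓝 0) := by
    simp only [hh, topLp_sub _ g₀, htop, hg₀L]
    exact tendsto_iff_norm_sub_tendsto_zero.1 hu
  let Λ : W m p →ₗ[ℝ] (Fin N → ℝ) := LinearMap.pi L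
  have hinj : LinearMap.ker (Λ ∘ₗ polyₗ m p) = ⊥ := LinearMap.ker_eq_bot'.2 fun b hb =>
    hsep b fun i => congrFun hb i
  -- Separation of polynomials makes the coefficients a continuous linear function of the values of
  -- the `L_i`, so convergence of these values gives convergence of the coefficients.
  obtain ⟨B, hB⟩ := LinearMap.exists_leftInverse_of_injective _ hinj
  have hBc : Continuous B := LinearMap.continuous_of_finiteDimensional B
  have hAc : Continuous (Λ ∘ₗ polyₗ m p) := LinearMap.continuous_of_finiteDimensional _
  have hΛh : Tendsto (fun n => Λ (h n)) atTop (𝓝 0) :=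
    tendsto_pi_nhds.2 fun i => tendsto_functional (hL i) hp0 hh0 hh_lim
  have hΛc : ∀ n, (Λ ∘ₗ polyₗ m p) (c n) = Λ (f n) - Λ g₀ - Λ (h n) := fun n => by
    conv_rhs => rw [hf n]
    rw [map_add, map_add, LinearMap.comp_apply]
    abel
  have hΛlim : Tendsto (fun n => (Λ ∘ₗ polyₗ m p) (c n)) atTop (𝓝 (z - Λ g₀)) := by
    simp only [hΛc]
    simpa using (Tendsto.sub_const (f := fun n => Λ (f n)) hz (Λ g₀)).sub hΛh
  have hBA : ∀ b, B ((Λ ∘ₗ polyₗ m p) b) = b := fun b => LinearMap.congr_fun hB b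
  have hclim : Tendsto c atTop (𝓝 (B (z - Λ g₀))) := by
    have := (hBc.tendsto _).comp hΛlim
    refine this.congr fun n => hBA (c n)
  set c' := B (z - Λ g₀) with hc'
  have hAc' : (Λ ∘ₗ polyₗ m p) c' = z - Λ g₀ :=
    tendsto_nhds_unique ((hAc.tendsto c').comp hclim) hΛlim
  refine ⟨g₀ + poly m p c', ?_, fun i => ?_, fun j hj t ht => ?_⟩
  · rw [← htop _ c', add_sub_cancel_right, hg₀L]
  · have := congrFun hAc' i
    rw [Pi.sub_apply] at this
    rw [map_add]
    exact add_eq_of_eq_sub' this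
  · have hDf : ∀ n, D j (f n) t = D j (poly m p (c n)) t + (D j g₀ t + D j (h n) t) := fun n => by
      conv_lhs => rw [hf n]
      rw [D_add_apply _ _ hj ht, D_add_apply _ _ hj ht]
      rfl
    have hDh : Tendsto (fun n => D j (h n) t) atTop (𝓝 0) :=
      squeeze_zero_norm (fun n => abs_D_le_norm_topLp hp (h n) (hh0 n) hj ht) hh_lim
    have hDp : Tendsto (fun n => D j (poly m p (c n)) t) atTop (𝓝 (D j (poly m p c') t)) := by
      simp only [D_poly _ j ht]
      exact tendsto_finsetSum _ fun k _ => ((tendsto_pi_nhds.1 hclim) k).mul_const _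
    rw [D_add_apply _ _ hj ht]
    simp only [hDf]
    have := hDp.add (hDh.const_add (D j g₀ t))
    rwa [add_zero, add_comm] at this

variable {lam : ℝ} {ρ : Fin N → ℝ → ℝ} {y : Fin N → ℝ}

theorem isBounded_sublevel_of_coercive {r : ℝ → ℝ} (hr : Tendsto r (cocompact ℝ) atTop) (M : ℝ) :
    Bornology.IsBounded {a | r a ≤ M} := by
  rw [Metric.isBounded_iff_subset_closedBall 0]
  have h := hr.eventually (eventually_gt_atTop M)
  rw [← Metric.cobounded_eq_cocompact] at h
  have hb : Bornology.IsBounded {a | ¬ M < r a} := by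
    rw [← compl_ofPred, Bornology.isBounded_compl_iff]
    exact h
  simpa only [not_lt] using hb.subset_closedBall 0

theorem exists_minimizer (hm : 1 ≤ m) (hℓ : ℓ ≤ m) (hp : 1 < p) (hlam : 0 < lam)
    (hx01 : ∀ k, x k ∈ Icc (0 : ℝ) 1) (hL : ∀ i, IsBoundedFunctional (L i))
    (hsep : SeparatesPolynomials L) (hρ : ∀ i, StrictConvexOn ℝ univ (ρ i))
    (hρc : ∀ i, Continuous (ρ i)) (hcoer : ∀ i, Tendsto (ρ i) (cocompact ℝ) atTop) :
    ∃ f ∈ cone ℓ m p x, IsMinOn (VP lam L ρ y) (cone ℓ m p x) f := by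
  have hp0 : 0 < p := by linarith
  have : Fact (1 ≤ ENNReal.ofReal p) := ⟨by simpa using hp.le⟩
  have hlp : 0 < lam / p := div_pos hlam hp0
  choose a ha using fun i => (hρc i).exists_forall_le (hcoer i)
  set S := VP lam L ρ y '' cone ℓ m p x
  have hSne : S.Nonempty := ⟨_, 0, zero_mem_cone, rfl⟩
  have hSbdd : BddBelow S := by
    refine ⟨∑ i, ρ i (a i), ?_⟩
    rintro _ ⟨f, -, rfl⟩
    rw [VP_eq]
    have := Finset.sum_le_sum fun i (_ : i ∈ Finset.univ) => ha i (L i f - y i)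
    have := mul_nonneg hlp.le (energy_nonneg f)
    linarith
  obtain ⟨v, hv_anti, hv_lim, hvS⟩ := exists_seq_tendsto_sInf hSne hSbdd
  choose f hf hfv using hvS
  set I₀ := sInf S
  have hI : ∀ g ∈ cone ℓ m p x, I₀ ≤ VP lam L ρ y g := fun g hg =>
    csInf_le hSbdd (mem_image_of_mem _ hg)
  have hle : ∀ n, lam / p * energy (f n) + ∑ i, ρ i (L i (f n) - y i) ≤ v 0 := fun n => by
    rw [← VP_eq, hfv]
    exact hv_anti (Nat.zero_le n)
  have hE : ∀ n, energy (f n) ≤ (v 0 - ∑ i, ρ i (a i)) / (lam / p) := fun n => by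
    rw [le_div_iff₀ hlp]
    have := Finset.sum_le_sum fun i (_ : i ∈ Finset.univ) => ha i (L i (f n) - y i)
    linarith [hle n]
  -- All other penalties are at least their minima and the energy is nonnegative, so each single
  -- penalty is bounded along the sequence.
  have hR : ∀ n i, ρ i (L i (f n) - y i) ≤ v 0 - ∑ i, ρ i (a i) + ρ i (a i) := fun n i => by
    have h1 := Finset.single_le_sum (f := fun i => ρ i (L i (f n) - y i) - ρ i (a i))
      (fun i _ => sub_nonneg.2 (ha i _)) (Finset.mem_univ i)
    rw [Finset.sum_sub_distrib] at h1
    have h2 := mul_nonneg hlp.le (energy_nonneg (f n))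
    linarith [hle n]
  have hgap : ∀ n k, (energy (f n) + energy (f k)) / 2 - energy ((1 / 2 : ℝ) • (f n + f k))
      ≤ (v n - I₀) / 2 / (lam / p) + (v k - I₀) / 2 / (lam / p) := fun n k => by
    have key := VP_midpoint (lam := lam) (L := L) (ρ := ρ) (y := y) (f n) (f k)
    have hmid := hI _ (smul_mem_cone (add_mem_cone hx01 (hf n) (hf k)) (c := 1 / 2) (by norm_num))
    have hS := Finset.sum_nonneg fun i (_ : i ∈ Finset.univ) =>
      StrictConvexOn.midpoint_nonneg (hρ i) (L i (f n) - y i) (L i (f k) - y i)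
    rw [hfv, hfv] at key
    rw [← add_div, le_div_iff₀ hlp]
    linarith
  have hδ : Tendsto (fun n => (v n - I₀) / 2 / (lam / p)) atTop (𝓝 0) := by
    have := ((hv_lim.sub_const I₀).div_const 2).div_const (lam / p)
    simpa using this
  obtain ⟨u, hu⟩ := cauchySeq_tendsto_of_complete (cauchySeq_topLp hp hE hδ hgap)
  have hbdd : Bornology.IsBounded (Set.pi univ fun i =>
      {b | ρ i b ≤ v 0 - ∑ i, ρ i (a i) + ρ i (a i)}) :=
    Bornology.IsBounded.pi fun i => isBounded_sublevel_of_coercive (hcoer i) _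
  obtain ⟨z, -, φ, hφ, hz⟩ := tendsto_subseq_of_bounded hbdd
    (x := fun n i => L i (f n) - y i) fun n => mem_univ_pi.2 fun i => hR n i
  have hz' : Tendsto (fun n i => L i (f (φ n))) atTop (𝓝 (z + y)) := by
    have := hz.add_const y
    refine this.congr fun n => funext fun i => ?_
    simp
  obtain ⟨g, hgu, hgz, hgD⟩ := exists_limit hm hp hL hsep (f := fun n => f (φ n))
    (hu.comp hφ.tendsto_atTop) hz'
  have hgcone : g ∈ cone ℓ m p x := mem_cone_of_tendsto hℓ hx01 (fun n => hf (φ n)) hgD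
    (by rw [hgu]; exact hu.comp hφ.tendsto_atTop)
  -- Norm convergence gives convergence of `VP` itself, so no lower semicontinuity argument is
  -- needed.
  have hVP : Tendsto (fun n => VP lam L ρ y (f (φ n))) atTop (𝓝 (VP lam L ρ y g)) := by
    simp only [VP_eq, energy_eq_norm_rpow hp0]
    refine Tendsto.add (Tendsto.const_mul _ ?_) (tendsto_finsetSum _ fun i _ => ?_)
    · rw [hgu]
      exact ((hu.comp hφ.tendsto_atTop).norm).rpow_const (Or.inr hp0.le)
    · rw [hgz]
      exact ((hρc i).tendsto _).comp (((tendsto_pi_nhds.1 hz') i).sub_const _)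
  have hVPg : VP lam L ρ y g = I₀ := tendsto_nhds_unique hVP <| by
    simp only [hfv]
    exact hv_lim.comp hφ.tendsto_atTop
  refine ⟨g, hgcone, fun w hw => ?_⟩
  rw [mem_ofPred_eq, hVPg]
  exact hI w hw

end

/-! ### Subgradients and the multiplier rule -/

theorem IsSubgradientAt.eq_deriv {r : ℝ → ℝ} {a z : ℝ} (h : IsSubgradientAt r a z)
    (hr : DifferentiableAt ℝ r z) : a = deriv r z := by
  have hd : HasDerivAt (fun w => r w - a * (w - z)) (deriv r z - a) z := by
    have := hr.hasDerivAt.fun_sub (((hasDerivAt_id z).sub_const z).const_mul a)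
    simpa using this
  have hmin : IsLocalMin (fun w => r w - a * (w - z)) z :=
    Eventually.of_forall fun w => by
      have := h w
      simp only [sub_self, mul_zero, sub_zero]
      linarith
  exact (sub_eq_zero.1 (hmin.hasDerivAt_eq_zero hd)).symm

/-- A Lagrange multiplier rule: a minimizer of `J + ∑ R_i ∘ Λ_i` over a convex set minimizes
`J + ∑ a_i Λ_i` for some subgradients `a_i` of `R_i`. -/
theorem exists_subgradient_multipliers {E : Type*} [AddCommGroup E] [Module ℝ E] {N : ℕ}
    {V : Set E} {J : E → ℝ} (hJ : ConvexOn ℝ V J) (Λ : Fin N → E →ₗ[ℝ] ℝ) {R : Fin N → ℝ → ℝ}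
    (hR : ∀ i, ConvexOn ℝ univ (R i)) (hRc : ∀ i, Continuous (R i)) {f : E} (hf : f ∈ V)
    (hmin : IsMinOn (fun g => J g + ∑ i, R i (Λ i g)) V f) :
    ∃ a : Fin N → ℝ, (∀ i, IsSubgradientAt (R i) (a i) (Λ i f)) ∧
      IsMinOn (fun g => J g + ∑ i, a i * Λ i g) V f := by
  let Λ' : E →ₗ[ℝ] (Fin N → ℝ) := LinearMap.pi Λ
  set S : (Fin N → ℝ) → ℝ := fun z => ∑ i, R i (z i) with hS
  have hSc : Continuous S := continuous_finsetSum _ fun i _ => (hRc i).comp (continuous_apply i)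
  have hSconv : ∀ z w : Fin N → ℝ, ∀ a b : ℝ, 0 ≤ a → 0 ≤ b → a + b = 1 →
      S (a • z + b • w) ≤ a * S z + b * S w := fun z w a b ha hb hab => by
    simp only [hS, Finset.mul_sum, ← Finset.sum_add_distrib]
    exact Finset.sum_le_sum fun i _ => (hR i).2 (mem_univ _) (mem_univ _) ha hb hab
  set z₀ := Λ' f with hz₀
  -- `B` is the open strict hypograph of `S z₀ - S`, while `A` collects the attainable increments of
  -- `J` with their `Λ'`-values. A common point would contradict minimality.
  set B : Set (ℝ × (Fin N → ℝ)) := {q | q.1 < S z₀ - S q.2} with hB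
  set A : Set (ℝ × (Fin N → ℝ)) := {q | ∃ g ∈ V, J g - J f ≤ q.1 ∧ Λ' g = q.2} with hA
  have hBo : IsOpen B :=
    isOpen_lt continuous_fst (continuous_const.sub (hSc.comp continuous_snd))
  have hBconv : Convex ℝ B := by
    intro q hq r hr a b ha hb hab
    rw [hB, mem_ofPred_eq] at hq hr ⊢
    have h1 := hSconv q.2 r.2 a b ha hb hab
    simp only [Prod.fst_add, Prod.snd_add, Prod.smul_fst, Prod.smul_snd, smul_eq_mul]
    have h2 : S z₀ = a * S z₀ + b * S z₀ := by rw [← add_mul, hab, one_mul]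
    have h3 : a * q.1 + b * r.1 < a * (S z₀ - S q.2) + b * (S z₀ - S r.2) := by
      rcases ha.eq_or_lt with rfl | ha'
      · rw [zero_add] at hab
        subst hab
        linarith
      · have := mul_lt_mul_of_pos_left hq ha'
        have := mul_le_mul_of_nonneg_left hr.le hb
        linarith
    linarith
  have hAconv : Convex ℝ A := by
    rintro q ⟨g, hg, hgq, hgq'⟩ r ⟨k, hk, hkr, hkr'⟩ a b ha hb hab
    refine ⟨a • g + b • k, hJ.1 hg hk ha hb hab, ?_, ?_⟩
    · have h1 := hJ.2 hg hk ha hb hab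
      have h2 := mul_le_mul_of_nonneg_left hgq ha
      have h3 := mul_le_mul_of_nonneg_left hkr hb
      have h4 : J f = a * J f + b * J f := by rw [← add_mul, hab, one_mul]
      simp only [Prod.fst_add, Prod.smul_fst, smul_eq_mul] at h1 ⊢
      linarith
    · rw [map_add, map_smul, map_smul, hgq', hkr']
      rfl
  have hdisj : Disjoint B A := by
    rw [Set.disjoint_left]
    rintro q hq ⟨g, hg, hgq, hgq'⟩
    rw [hB, mem_ofPred_eq, ← hgq'] at hq
    have h : J f + S z₀ ≤ J g + S (Λ' g) := hmin hg
    linarith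
  obtain ⟨φ, u, hφB, hφA⟩ := geometric_hahn_banach_open hBconv hBo hAconv hdisj
  set α := φ (1, 0) with hα
  have hdec : ∀ (r : ℝ) (z : Fin N → ℝ), φ (r, z) = r * α + φ (0, z) := fun r z => by
    have e : ((r, z) : ℝ × (Fin N → ℝ)) = r • ((1 : ℝ), (0 : Fin N → ℝ)) + (0, z) := by simp
    rw [e, map_add, map_smul, smul_eq_mul]
  set b : Fin N → ℝ := fun i => φ (0, Pi.single i 1) with hb
  have hdec2 : ∀ z : Fin N → ℝ, φ (0, z) = ∑ i, b i * z i := fun z => by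
    have h := LinearMap.pi_apply_eq_sum_univ
      ((φ : ℝ × (Fin N → ℝ) →ₗ[ℝ] ℝ) ∘ₗ LinearMap.inr ℝ ℝ (Fin N → ℝ)) z
    simp only [LinearMap.comp_apply, LinearMap.inr_apply, ContinuousLinearMap.coe_coe,
      smul_eq_mul] at h
    rw [h]
    refine Finset.sum_congr rfl fun i _ => ?_
    rw [mul_comm, hb]
    congr 3
    funext k
    simp [Pi.single_apply, eq_comm]
  have hA0 : u ≤ φ (0, z₀) := hφA _ ⟨f, hf, by simp, rfl⟩
  -- The separating hyperplane is not vertical: `B` contains a point directly below `(0, z₀)`, which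
  -- lies in `A`.
  have hα0 : 0 < α := by
    have := hφB (-1, z₀) (by simp [hB])
    rw [hdec] at this
    linarith
  have hBz : ∀ z, (S z₀ - S z) * α + φ (0, z) ≤ u := fun z => by
    refine le_of_forall_pos_le_add fun ε hε => ?_
    have h1 := hφB (S z₀ - S z - ε / α, z) (by
      rw [hB, mem_ofPred_eq]
      have := div_pos hε hα0
      simp only
      linarith)
    rw [hdec, sub_mul, div_mul_cancel₀ _ hα0.ne'] at h1
    linarith
  have hu : u = φ (0, z₀) := by
    refine le_antisymm hA0 ?_
    have := hBz z₀
    rwa [sub_self, zero_mul, zero_add] at this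
  have hsum : ∀ z : Fin N → ℝ, ∑ i, b i / α * z i = φ (0, z) / α := fun z => by
    rw [hdec2, Finset.sum_div]
    exact Finset.sum_congr rfl fun i _ => by ring
  refine ⟨fun i => b i / α, fun i w => ?_, fun g hg => ?_⟩
  -- Varying one coordinate isolates the subgradient inequality of a single `R i`.
  · have h1 := hBz (Function.update z₀ i w)
    have h2 : S (Function.update z₀ i w) - S z₀ = R i w - R i (z₀ i) := by
      rw [hS]
      simp only
      rw [← Finset.sum_sub_distrib, Finset.sum_eq_single i]
      · simp
      · intro k _ hk
        rw [Function.update_of_ne hk, sub_self]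
      · simp
    have h3 : φ (0, Function.update z₀ i w) - φ (0, z₀) = b i * (w - z₀ i) := by
      rw [hdec2, hdec2, ← Finset.sum_sub_distrib, Finset.sum_eq_single i]
      · simp [mul_sub]
      · intro k _ hk
        rw [Function.update_of_ne hk, sub_self]
      · simp
    have h4 : b i * (w - z₀ i) ≤ (R i w - R i (z₀ i)) * α := by
      rw [← h2, ← h3]
      linarith
    rw [← div_le_iff₀ hα0] at h4
    have e : b i / α * (w - z₀ i) = b i * (w - z₀ i) / α := by ring
    change R i (z₀ i) + b i / α * (w - z₀ i) ≤ R i w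
    linarith
  · have h1 := hφA (J g - J f, Λ' g) ⟨g, hg, le_rfl, rfl⟩
    rw [hdec, hu] at h1
    have h2 : J f + φ (0, Λ' f) / α ≤ J g + φ (0, Λ' g) / α := by
      have h5 := mul_le_mul_of_nonneg_right h1 (inv_nonneg.2 hα0.le)
      rw [add_mul, mul_assoc, mul_inv_cancel₀ hα0.ne', mul_one] at h5
      rw [div_eq_mul_inv, div_eq_mul_inv]
      linarith
    rw [← hsum, ← hsum] at h2
    exact h2

/-! ### First variation and the Euler–Lagrange equation for `ℓ < m` -/

section

variable {m : ℕ} {p : ℝ}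

theorem convexOn_energy (hp : 1 < p) : ConvexOn ℝ univ (energy : W m p → ℝ) := by
  have hp0 : 0 < p := by linarith
  refine ⟨convex_univ, fun f _ g _ a b ha hb hab => ?_⟩
  have hf := (integrable_energy hp0 f).const_mul a
  have hg := (integrable_energy hp0 g).const_mul b
  rw [energy, energy, energy, smul_eq_mul, smul_eq_mul, ← integral_const_mul,
    ← integral_const_mul, ← integral_add hf hg]
  refine integral_mono_ae (integrable_energy hp0 _) (hf.add hg) ?_
  filter_upwards [D_top_add (a • f) (b • g)] with t ht
  simp only [ht, D_smul_apply]
  have h1 := (convexOn_rpow hp.le).2 (abs_nonneg (D m f t)) (abs_nonneg (D m g t)) ha hb hab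
  refine le_trans (Real.rpow_le_rpow (abs_nonneg _) ?_ hp0.le) h1
  refine (abs_add_le _ _).trans_eq ?_
  rw [abs_mul, abs_mul, abs_of_nonneg ha, abs_of_nonneg hb]
  rfl

theorem abs_rpow_sub_two_mul (hp : 1 < p) (w : ℝ) : |(|w| ^ (p - 2) * w)| = |w| ^ (p - 1) := by
  rcases eq_or_ne w 0 with rfl | hw
  · rw [mul_zero, abs_zero, Real.zero_rpow (by linarith)]
  · rw [abs_mul, abs_of_nonneg (Real.rpow_nonneg (abs_nonneg w) _),
      ← Real.rpow_add_one (abs_pos.2 hw).ne']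
    ring_nf

/-- Differentiation under the integral is justified for `|s| < 1` by the dominating function `p (|u|
+ |v|)^p`. -/
theorem hasDerivAt_integral_abs_add_rpow (hp : 1 < p) {u v : ℝ → ℝ}
    (hu : MemLp u (ENNReal.ofReal p) unitMeasure) (hv : MemLp v (ENNReal.ofReal p) unitMeasure) :
    Integrable (fun t => p * (|u t| ^ (p - 2) * u t) * v t) unitMeasure ∧
    HasDerivAt (fun s : ℝ => ∫ t, |u t + s * v t| ^ p ∂unitMeasure)
      (∫ t, p * (|u t| ^ (p - 2) * u t) * v t ∂unitMeasure) 0 := by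
  have hp0 : 0 < p := by linarith
  have hF : ∀ s : ℝ, MemLp (fun t => u t + s * v t) (ENNReal.ofReal p) unitMeasure :=
    fun s => hu.add (hv.const_mul s)
  have hM : MemLp (fun t => |u t| + |v t|) (ENNReal.ofReal p) unitMeasure := hu.abs.add hv.abs
  have key := hasDerivAt_integral_of_dominated_loc_of_deriv_le (μ := unitMeasure)
    (F := fun (s : ℝ) t => |u t + s * v t| ^ p) (x₀ := 0) (s := Metric.ball 0 1)
    (F' := fun s t => p * (|u t + s * v t| ^ (p - 2) * (u t + s * v t)) * v t)
    (bound := fun t => p * |(|u t| + |v t|)| ^ p)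
    (Metric.ball_mem_nhds 0 one_pos)
    (Eventually.of_forall fun s => (integrable_abs_rpow hp0 (hF s)).aestronglyMeasurable)
    (integrable_abs_rpow hp0 (hF 0)) ?_ ?_ ((integrable_abs_rpow hp0 hM).const_mul p) ?_
  · simpa only [zero_mul, add_zero] using key
  · have h0 := (hF 0).1.aemeasurable
    have h1 : AEMeasurable (fun t => |u t + 0 * v t|) unitMeasure := measurable_abs.comp_aemeasurable h0
    exact ((((h1.pow_const (p - 2)).mul h0).const_mul p).mul hv.1.aemeasurable).aestronglyMeasurable
  · refine Eventually.of_forall fun t s hs => ?_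
    rw [mem_ball_zero_iff, Real.norm_eq_abs] at hs
    set M := |u t| + |v t|
    have hM0 : 0 ≤ M := by positivity
    have hw : |u t + s * v t| ≤ M := by
      refine (abs_add_le _ _).trans (add_le_add le_rfl ?_)
      rw [abs_mul]
      exact mul_le_of_le_one_left (abs_nonneg _) hs.le
    have hv' : |v t| ≤ M := le_add_of_nonneg_left (abs_nonneg _)
    have e : M ^ p = M ^ (p - 1) * M := by
      rcases hM0.eq_or_lt with h | h
      · rw [← h, mul_zero, Real.zero_rpow hp0.ne']
      · rw [← Real.rpow_add_one h.ne', sub_add_cancel]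
    rw [Real.norm_eq_abs, abs_mul, abs_mul, abs_rpow_sub_two_mul hp, abs_of_nonneg hM0,
      abs_of_pos hp0, e, mul_assoc]
    gcongr
  · refine Eventually.of_forall fun t s _ => ?_
    have h1 : HasDerivAt (fun s => u t + s * v t) (v t) s := by
      simpa using ((hasDerivAt_id s).mul_const (v t)).const_add (u t)
    have h2 := (hasDerivAt_abs_rpow (u t + s * v t) hp).comp s h1
    rw [← mul_assoc p]
    exact h2

theorem hasDerivAt_energy (hp : 1 < p) (f ψ : W m p) :
    Integrable (fun t => |D m f t| ^ (p - 2) * D m f t * D m ψ t) unitMeasure ∧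
    HasDerivAt (fun s : ℝ => energy (f + s • ψ))
      (p * ∫ t, |D m f t| ^ (p - 2) * D m f t * D m ψ t ∂unitMeasure) 0 := by
  obtain ⟨h1, h2⟩ := hasDerivAt_integral_abs_add_rpow hp f.2.memLp ψ.2.memLp
  have hp0 : p ≠ 0 := by linarith
  constructor
  · refine (h1.const_mul p⁻¹).congr (Eventually.of_forall fun t => ?_)
    simp only
    field_simp
  · rw [← integral_const_mul]
    simp only [mul_assoc] at h2 ⊢
    convert h2 using 2 with s
    rw [energy]
    refine integral_congr_ae ?_
    filter_upwards [D_top_add f (s • ψ)] with t ht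
    simp only [ht, D_smul_apply]

variable {ℓ K N : ℕ} {x : Fin K → ℝ} {lam : ℝ} {L : Fin N → W m p →ₗ[ℝ] ℝ}
  {a : Fin N → ℝ} {f : W m p}

/-- Both signs of `s` are admissible, so the one-variable function has an interior local minimum at
`0`, giving an equation instead of a variational inequality. -/
theorem stationary_of_isMinOn (hp : 1 < p)
    (hmin : IsMinOn (fun g => lam / p * energy g + ∑ i, a i * L i g) (cone ℓ m p x) f)
    {ψ : W m p} {s₀ : ℝ} (hs₀ : 0 < s₀) (hψ : ∀ s : ℝ, |s| ≤ s₀ → f + s • ψ ∈ cone ℓ m p x) :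
    lam * (∫ t, |D m f t| ^ (p - 2) * D m f t * D m ψ t ∂unitMeasure) + ∑ i, a i * L i ψ = 0 := by
  have hp0 : p ≠ 0 := by linarith
  have hlin : HasDerivAt (fun s : ℝ => ∑ i, a i * L i (f + s • ψ)) (∑ i, a i * L i ψ) 0 := by
    refine HasDerivAt.fun_sum fun i _ => ?_
    simp only [map_add, map_smul, smul_eq_mul]
    simpa using (((hasDerivAt_id (0 : ℝ)).mul_const (L i ψ)).const_add (L i f)).const_mul (a i)
  have hd := ((hasDerivAt_energy hp f ψ).2.const_mul (lam / p)).add hlin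
  have hloc : IsLocalMin ((fun s : ℝ => lam / p * energy (f + s • ψ))
      + fun s : ℝ => ∑ i, a i * L i (f + s • ψ)) 0 := by
    filter_upwards [Metric.closedBall_mem_nhds (0 : ℝ) hs₀] with s hs
    rw [mem_closedBall_zero_iff, Real.norm_eq_abs] at hs
    have := hmin (hψ s hs)
    simpa using this
  have := hloc.hasDerivAt_eq_zero hd
  rwa [← mul_assoc, div_mul_cancel₀ _ hp0] at this

theorem nonneg_of_abs_le_abs {ε d e : ℝ} (hε : |ε| = 1) (hd : 0 ≤ ε * d) (he : |e| ≤ |d|) :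
    0 ≤ ε * (d + e) := by
  have h1 : ε * d = |d| := by rw [← abs_of_nonneg hd, abs_mul, hε, one_mul]
  have h2 : -|e| ≤ ε * e := by
    have := neg_abs_le (ε * e)
    rwa [abs_mul, hε, one_mul] at this
  rw [mul_add, h1]
  linarith

/-- A perturbation dominated by `|f^{(ℓ)}|` cannot reverse its sign. -/
theorem add_mem_cone_of_abs_le (hx01 : ∀ k, x k ∈ Icc (0 : ℝ) 1) {ψ : W m p}
    (hf : f ∈ cone ℓ m p x)
    (hlt : ℓ < m → ∀ t ∈ Icc (0 : ℝ) 1, |D ℓ ψ t| ≤ |D ℓ f t|)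
    (heq : ℓ = m → ∀ᵐ t ∂unitMeasure, |D ℓ ψ t| ≤ |D ℓ f t|) : f + ψ ∈ cone ℓ m p x := by
  have hε : ∀ j : ℕ, |(-1 : ℝ) ^ j| = 1 := fun j => by simp
  refine fun j => ⟨fun h t ht => ?_, fun h => ?_⟩
  · have ht' := Icc_knots_subset hx01 _ _ ht
    rw [D_add_apply f ψ h ht']
    exact nonneg_of_abs_le_abs (hε j) ((hf j).1 h t ht) (hlt h t ht')
  · subst h
    filter_upwards [(hf j).2 rfl, ae_Icc_knots hx01 _ _ (D_top_add f ψ),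
      ae_Icc_knots hx01 _ _ (heq rfl)] with t h1 h2 h3
    rw [h2]
    exact nonneg_of_abs_le_abs (hε j) h1 h3

theorem iteratedDeriv_eq_zero_of_notMem_tsupport {φ : ℝ → ℝ} (j : ℕ) {t : ℝ}
    (ht : t ∉ tsupport φ) : iteratedDeriv j φ t = 0 := by
  have h : φ =ᶠ[𝓝 t] fun _ => 0 := notMem_tsupport_iff_eventuallyEq.1 ht
  rw [h.iteratedDeriv_eq]
  simp

theorem D_ofSmooth {φ : ℝ → ℝ} (hφ : ContDiff ℝ ∞ φ) (j : ℕ) {t : ℝ} (ht : t ∈ Icc (0 : ℝ) 1) :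
    D j (ofSmooth m p φ hφ) t = iteratedDeriv j φ t :=
  D_restrict hφ j ht

theorem eulerLagrangeOn_iff {U : Set ℝ} : EulerLagrangeOn lam L a f U ↔
    ∀ (φ : ℝ → ℝ) (hφ : ContDiff ℝ ∞ φ), HasCompactSupport φ → tsupport φ ⊆ U →
      lam * (∫ t, |D m f t| ^ (p - 2) * D m f t * D m (ofSmooth m p φ hφ) t ∂unitMeasure)
        + ∑ i, a i * L i (ofSmooth m p φ hφ) = 0 := by
  refine forall_congr' fun φ => forall_congr' fun hφ => ?_
  have e : (-1 : ℝ) ^ m * lam * distDeriv m (fun t => |D m f t| ^ (p - 2) * D m f t) φ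
      = lam * ∫ t, |D m f t| ^ (p - 2) * D m f t * D m (ofSmooth m p φ hφ) t ∂unitMeasure := by
    rw [distDeriv, integral_zero_one_eq, mul_right_comm, ← mul_assoc, ← mul_pow, neg_one_mul,
      neg_neg, one_pow, one_mul, mul_comm]
    congr 1
    exact setIntegral_congr_fun measurableSet_Icc fun t ht => by simp only [D_ofSmooth hφ m ht]
  rw [e]

theorem eulerLagrangeOn_of_lt (hp : 1 < p) (hx01 : ∀ k, x k ∈ Icc (0 : ℝ) 1)
    (hf : f ∈ cone ℓ m p x)
    (hmin : IsMinOn (fun g => lam / p * energy g + ∑ i, a i * L i g) (cone ℓ m p x) f)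
    (hℓ : ℓ < m) {U : Set ℝ} (hU : IsNonvanishingRegion ℓ f U) : EulerLagrangeOn lam L a f U := by
  refine eulerLagrangeOn_iff.2 fun φ hφ hc hsupp => ?_
  have hK : IsCompact (tsupport φ) := hc
  have hcont : ContinuousOn (D ℓ f) (Icc (0 : ℝ) 1) := by
    have := (f.2.absCont ℓ hℓ).continuousOn
    rwa [uIcc_of_le zero_le_one] at this
  have hKI : tsupport φ ⊆ Icc (0 : ℝ) 1 := fun t ht => Ioo_subset_Icc_self (hU.2.1 (hsupp ht))
  obtain ⟨δ, hδ, hδK⟩ : ∃ δ : ℝ, 0 < δ ∧ ∀ t ∈ tsupport φ, δ ≤ |D ℓ f t| := by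
    rcases (tsupport φ).eq_empty_or_nonempty with h | h
    · exact ⟨1, one_pos, by simp [h]⟩
    · obtain ⟨t, ht, hmin⟩ := hK.exists_isMinOn h (hcont.mono hKI).abs
      exact ⟨_, hU.2.2.1 hℓ t (hsupp ht), fun s hs => hmin hs⟩
  obtain ⟨C, hC⟩ := hK.exists_bound_of_continuousOn
    (contDiff_iteratedDeriv hφ ℓ).continuous.continuousOn
  -- On the support `|f^{(ℓ)}| ≥ δ` and `|φ^{(ℓ)}| ≤ C`; off it the perturbation vanishes. The form
  -- `|C| + 1` keeps the denominator positive even for empty support.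
  refine stationary_of_isMinOn hp hmin (s₀ := δ / (|C| + 1)) (by positivity) fun s hs => ?_
  refine add_mem_cone_of_abs_le hx01 hf (fun _ t ht => ?_) fun h => absurd h hℓ.ne
  rw [D_smul_apply, D_ofSmooth hφ ℓ ht]
  by_cases htK : t ∈ tsupport φ
  · refine le_trans ?_ (hδK t htK)
    rw [abs_mul]
    have h1 : |iteratedDeriv ℓ φ t| ≤ |C| + 1 := by
      have := hC t htK
      rw [Real.norm_eq_abs] at this
      linarith [le_abs_self C]
    calc |s| * |iteratedDeriv ℓ φ t| ≤ δ / (|C| + 1) * (|C| + 1) := by gcongr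
      _ = δ := div_mul_cancel₀ _ (by positivity)
  · rw [iteratedDeriv_eq_zero_of_notMem_tsupport ℓ htK, mul_zero, abs_zero]
    exact abs_nonneg _

/-! ### Truncation and the Euler–Lagrange equation for `ℓ = m` -/

/-- The truncation of `b` to `[-c, c]`. -/
def truncate (c b : ℝ) : ℝ := max (-c) (min b c)

theorem abs_truncate_le {c : ℝ} (hc : 0 ≤ c) (b : ℝ) : |truncate c b| ≤ c := by
  rw [truncate, abs_le]
  exact ⟨le_max_left _ _, max_le (by linarith) (min_le_right _ _)⟩

theorem truncate_of_abs_le {c b : ℝ} (h : |b| ≤ c) : truncate c b = b := by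
  rw [abs_le] at h
  rw [truncate, min_eq_left h.2, max_eq_right h.1]

theorem abs_truncate_le_abs {c : ℝ} (hc : 0 ≤ c) (b : ℝ) : |truncate c b| ≤ |b| := by
  by_cases h : |b| ≤ c
  · rw [truncate_of_abs_le h]
  · exact (abs_truncate_le hc b).trans (not_le.1 h).le

theorem tendsto_truncate {d b : ℝ} (h : d ≠ 0 ∨ b = 0) :
    Tendsto (fun n : ℕ => truncate (n * |d|) b) atTop (𝓝 b) := by
  refine tendsto_const_nhds.congr' ?_
  rcases h with h | h
  · have hlim : Tendsto (fun n : ℕ => (n : ℝ) * |d|) atTop atTop :=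
      tendsto_natCast_atTop_atTop.atTop_mul_const (abs_pos.2 h)
    filter_upwards [hlim.eventually_ge_atTop |b|] with n hn
    exact (truncate_of_abs_le hn).symm
  · refine Eventually.of_forall fun n => (truncate_of_abs_le ?_).symm
    rw [h, abs_zero]
    positivity

theorem eulerLagrangeOn_top (hm : 1 ≤ m) (hp : 1 < p) (hx01 : ∀ k, x k ∈ Icc (0 : ℝ) 1)
    (hL : ∀ i, IsBoundedFunctional (L i)) (hf : f ∈ cone m m p x)
    (hmin : IsMinOn (fun g => lam / p * energy g + ∑ i, a i * L i g) (cone m m p x) f)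
    {U : Set ℝ} (hU : IsNonvanishingRegion m f U) : EulerLagrangeOn lam L a f U := by
  refine eulerLagrangeOn_iff.2 fun φ hφ hc hsupp => ?_
  have hp0 : 0 < p := by linarith
  set Φ := ofSmooth m p φ hφ with hΦ
  have hΦ0 : ∀ j < m, D j Φ 0 = 0 := fun j _ => by
    rw [hΦ, D_ofSmooth hφ j (left_mem_Icc.2 zero_le_one)]
    exact iteratedDeriv_eq_zero_of_notMem_tsupport j fun h => (hU.2.1 (hsupp h)).1.false
  have hne : ∀ᵐ t ∂unitMeasure, D m f t ≠ 0 ∨ D m Φ t = 0 := by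
    have h1 := ae_restrict_of_ae (s := Icc (0 : ℝ) 1)
      ((ae_restrict_iff' hU.1.measurableSet).1 (hU.2.2.2 rfl))
    filter_upwards [h1, ae_restrict_mem measurableSet_Icc] with t ht htI
    by_cases htK : t ∈ tsupport φ
    · exact Or.inl (abs_pos.1 (ht (hsupp htK)))
    · exact Or.inr ((D_ofSmooth hφ m htI).trans (iteratedDeriv_eq_zero_of_notMem_tsupport m htK))
  have hmeas : ∀ n : ℕ, AEStronglyMeasurable
      (fun t => truncate (n * |D m f t|) (D m Φ t)) unitMeasure := fun n => by
    have h1 : AEStronglyMeasurable (fun t => (n : ℝ) * |D m f t|) unitMeasure :=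
      f.2.memLp.abs.1.const_mul (n : ℝ)
    exact h1.neg.sup (Φ.2.memLp.1.inf h1)
  have hnn : ∀ (n : ℕ) (t : ℝ), 0 ≤ (n : ℝ) * |D m f t| := fun n t => by positivity
  -- The `ψ n` need not be supported in `U`: for `ℓ = m` the cone constrains only the `m`-th
  -- derivative, and that is dominated by `n |f^{(m)}|`.
  choose ψ hψ0 hψ using fun n : ℕ => exists_primitive hm hp.le
    (Φ.2.memLp.of_le (hmeas n) (Eventually.of_forall fun t => abs_truncate_le_abs (hnn n t) _))
  have hstat : ∀ n, lam * (∫ t, |D m f t| ^ (p - 2) * D m f t * D m (ψ n) t ∂unitMeasure)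
      + ∑ i, a i * L i (ψ n) = 0 := fun n => by
    refine stationary_of_isMinOn hp hmin (s₀ := 1 / (n + 1 : ℝ)) (by positivity) fun s hs => ?_
    refine add_mem_cone_of_abs_le hx01 hf (fun h => absurd h (lt_irrefl m)) fun _ => ?_
    filter_upwards [hψ n] with t ht
    rw [D_smul_apply, ht, abs_mul]
    calc |s| * |truncate (n * |D m f t|) (D m Φ t)| ≤ 1 / (n + 1) * (n * |D m f t|) := by
          gcongr
          exact abs_truncate_le (hnn n t) _
      _ = n / (n + 1) * |D m f t| := by ring
      _ ≤ |D m f t| := by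
          refine mul_le_of_le_one_left (abs_nonneg _) ?_
          rw [div_le_one (by positivity)]
          linarith
  have hlim : ∀ᵐ t ∂unitMeasure, Tendsto (fun n => D m (ψ n) t) atTop (𝓝 (D m Φ t)) := by
    filter_upwards [hne, ae_all_iff.2 hψ] with t ht h
    simp only [h]
    exact tendsto_truncate ht
  have hbd : ∀ n, ∀ᵐ t ∂unitMeasure, |D m (ψ n) t| ≤ |D m Φ t| := fun n => by
    filter_upwards [hψ n] with t ht
    rw [ht]
    exact abs_truncate_le_abs (hnn n t) _
  have hint : Tendsto (fun n => ∫ t, |D m f t| ^ (p - 2) * D m f t * D m (ψ n) t ∂unitMeasure)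
      atTop (𝓝 (∫ t, |D m f t| ^ (p - 2) * D m f t * D m Φ t ∂unitMeasure)) := by
    refine tendsto_integral_of_dominated_convergence
      (fun t => ‖|D m f t| ^ (p - 2) * D m f t * D m Φ t‖)
      (fun n => (hasDerivAt_energy hp f (ψ n)).1.aestronglyMeasurable)
      (hasDerivAt_energy hp f Φ).1.norm (fun n => ?_) ?_
    · filter_upwards [hbd n] with t ht
      rw [norm_mul _ (D m (ψ n) t), norm_mul _ (D m Φ t)]
      exact mul_le_mul_of_nonneg_left ht (norm_nonneg (|D m f t| ^ (p - 2) * D m f t))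
    · filter_upwards [hlim] with t ht
      exact ht.const_mul _
  -- Since `ψ n` and `Φ` both have zero data at `0`, this is convergence in `W_{m,p}`, which the
  -- bounded functionals need.
  have hen : Tendsto (fun n => energy (ψ n - Φ)) atTop (𝓝 0) := by
    have h0 : ∫ _ : ℝ, (0 : ℝ) ∂unitMeasure = 0 := integral_zero _ _
    rw [← h0]
    refine tendsto_integral_of_dominated_convergence (fun t => |2 * D m Φ t| ^ p)
      (fun n => (integrable_energy hp0 _).aestronglyMeasurable)
      (integrable_abs_rpow hp0 (Φ.2.memLp.const_mul 2)) (fun n => ?_) ?_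
    · filter_upwards [hbd n, D_top_sub (ψ n) Φ] with t ht h
      rw [Real.norm_eq_abs, abs_of_nonneg (Real.rpow_nonneg (abs_nonneg _) _), h]
      refine Real.rpow_le_rpow (abs_nonneg _) ?_ hp0.le
      rw [abs_mul, abs_two]
      linarith [abs_sub (D m (ψ n) t) (D m Φ t)]
    · filter_upwards [hlim, ae_all_iff.2 fun n => D_top_sub (ψ n) Φ] with t ht h
      simp only [h]
      have := ((ht.sub_const (D m Φ t)).abs).rpow_const (p := p) (Or.inr hp0.le)
      rwa [sub_self, abs_zero, Real.zero_rpow hp0.ne'] at this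
  have hnorm : Tendsto (fun n => ‖topLp (ψ n - Φ)‖) atTop (𝓝 0) := by
    simp only [norm_topLp hp0]
    have := hen.rpow_const (p := 1 / p) (Or.inr (by positivity))
    rwa [Real.zero_rpow (by positivity)] at this
  have hLlim : ∀ i, Tendsto (fun n => L i (ψ n)) atTop (𝓝 (L i Φ)) := fun i => by
    have := tendsto_functional (hL i) hp0 (fun n j hj => by
      rw [D_sub_apply _ _ hj (left_mem_Icc.2 zero_le_one), hψ0 n j hj, hΦ0 j hj, sub_zero]) hnorm
    simp only [map_sub] at this
    simpa using this.add_const (L i Φ)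
  refine tendsto_nhds_unique ((hint.const_mul lam).add
    (tendsto_finsetSum _ fun i _ => (hLlim i).const_mul (a i))) ?_
  simp only [hstat]
  exact tendsto_const_nhds

theorem exists_multipliers (hp : 1 < p) (hlam : 0 < lam) (hx01 : ∀ k, x k ∈ Icc (0 : ℝ) 1)
    {ρ : Fin N → ℝ → ℝ} {y : Fin N → ℝ} (hρ : ∀ i, StrictConvexOn ℝ univ (ρ i))
    (hρc : ∀ i, Continuous (ρ i)) (hf : f ∈ cone ℓ m p x)
    (hmin : IsMinOn (VP lam L ρ y) (cone ℓ m p x) f) :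
    ∃ a : Fin N → ℝ, (∀ i, IsSubgradientAt (ρ i) (a i) (L i f - y i)) ∧
      IsMinOn (fun g => lam / p * energy g + ∑ i, a i * L i g) (cone ℓ m p x) f := by
  have hJ : ConvexOn ℝ (cone ℓ m p x) fun g => lam / p * energy g :=
    ((convexOn_energy hp).subset (subset_univ _) (convex_cone hx01)).smul (by positivity)
  -- The shift by `y i` is absorbed into the penalty, so that the multiplier rule sees the linear
  -- maps `L i` alone.
  obtain ⟨a, ha, hmin'⟩ := exists_subgradient_multipliers hJ L (R := fun i z => ρ i (z - y i))
    (fun i => by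
      have := (hρ i).convexOn.translate_left (-y i)
      rw [preimage_univ] at this
      simp only [sub_eq_add_neg]
      exact this)
    (fun i => (hρc i).comp (continuous_id.sub continuous_const)) hf
    (fun g hg => by simpa only [mem_ofPred_eq, VP_eq] using hmin hg)
  refine ⟨a, fun i w => ?_, hmin'⟩
  have := ha i (w + y i)
  simp only [add_sub_cancel_right] at this
  rwa [show w - (L i f - y i) = w + y i - L i f by ring]

end

end

end RobustSpline

open RobustSpline
theorem mainTheorem1
    (m ℓ K N : ℕ) (hm : 1 ≤ m) (hℓ : ℓ ≤ m)
    (p : ℝ) (hp : 1 < p) (lam : ℝ) (hlam : 0 < lam)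
    (x : Fin K → ℝ) (hx : Monotone x) (hx01 : ∀ k, x k ∈ Icc (0 : ℝ) 1)
    (L : Fin N → W m p →ₗ[ℝ] ℝ) (hL : ∀ i, IsBoundedFunctional (L i))
    (hsep : SeparatesPolynomials L)
    (y : Fin N → ℝ)
    (ρ : Fin N → ℝ → ℝ) (hρconv : ∀ i, StrictConvexOn ℝ univ (ρ i))
    (hρcont : ∀ i, Continuous (ρ i)) :
    -- existence and uniqueness
    ((∀ i, Tendsto (ρ i) (cocompact ℝ) atTop) →
      ∃! f : W m p, f ∈ cone ℓ m p x ∧ IsMinOn (VP lam L ρ y) (cone ℓ m p x) f) ∧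
    -- uniqueness without coercivity
    (∀ f ∈ cone ℓ m p x, ∀ g ∈ cone ℓ m p x,
      IsMinOn (VP lam L ρ y) (cone ℓ m p x) f → IsMinOn (VP lam L ρ y) (cone ℓ m p x) g →
        f = g) ∧
    -- the Euler-Lagrange equation
    (∀ f ∈ cone ℓ m p x, IsMinOn (VP lam L ρ y) (cone ℓ m p x) f →
      ∃ a : Fin N → ℝ,
        (∀ i, IsSubgradientAt (ρ i) (a i) (L i f - y i)) ∧
        (∀ i, DifferentiableAt ℝ (ρ i) (L i f - y i) → a i = deriv (ρ i) (L i f - y i)) ∧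
        ∀ U : Set ℝ, IsNonvanishingRegion ℓ f U → EulerLagrangeOn lam L a f U) := by
  refine ⟨fun hcoer => ?_, fun f hf g hg hfm hgm =>
    minimizer_unique hm hp hlam hx01 hsep hρconv hf hg hfm hgm, fun f hf hfm => ?_⟩
  · obtain ⟨f, hf, hfm⟩ :=
      exists_minimizer (x := x) (y := y) hm hℓ hp hlam hx01 hL hsep hρconv hρcont hcoer
    exact ⟨f, ⟨hf, hfm⟩, fun g hg =>
      minimizer_unique hm hp hlam hx01 hsep hρconv hg.1 hf hg.2 hfm⟩
  · obtain ⟨a, ha, hmin⟩ := exists_multipliers hp hlam hx01 hρconv hρcont hf hfm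
    refine ⟨a, ha, fun i hi => (ha i).eq_deriv hi, fun U hU => ?_⟩
    rcases hℓ.lt_or_eq with h | rfl
    · exact eulerLagrangeOn_of_lt hp hx01 hf hmin h hU
    · exact eulerLagrangeOn_top hm hp hx01 hL hf hmin hU
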